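/- **Setting.** Let $d\ge 1$, $k\ge 1$, and let $p$ be a symmetric, translation invariant, finite range, irreducible Markov transition function on $\mathbb Z^d$, i.e. $p\ge 0$, $p(i,j)=p(j,i)=p(0,j-i)$, $\sum_j p(i,j)=1$, $p(i,j)=0$ for $|i-j|>R$ (some $R>0$), and any two sites are joined by a path of steps of positive probability. Let $\rho>0$ and let $\nu_\rho$ be the product measure on $\mathbb N^{\mathbb Z^d}$ with Poisson($\rho$) marginals. Let $\{\eta(t):t\ge 0\}$ be the system of independent random walkers started from $\nu_\rho$: the initial numbers of particles $\eta_x(0)$ are distributed according to $\nu_\rho$, and, independently of them, the particles perform independent continuous-time random walks which jump from $i$ to $j$ at rate $p(i,j)$; $\eta_x(t)$ is the number of particles at $x$ at time $t$ (this is the Markov process with generator $\mathcal Lf(\eta)=\sum_{i,j}p(i,j)\,\eta_i\,(f(\eta^{ij})-f(\eta))$, where $\eta^{ij}$ is $\eta$ with one particle moved from $i$ to $j$). $\mathbb E_{\nu_\rho}$ is the expectation for this process. For $m,n\in\mathbb N$ let $d(m,n)=\sum_{j=0}^{m}\binom mj(-\rho)^{-j}\,n(n-1)\cdots(n-j+1)$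 be the Charlier polynomials, and for a configuration $\xi$ with finitely many particles let $D(\xi,\eta)=\prod_{u\in\mathbb Z^d}d(\xi_u,\eta_u)$. For $\mathbf x=(x_1,\dots,x_k)\in(\mathbb Z^d)^k$ and $z\in\mathbb Z^d$ let $\xi(\mathbf x)=\sum_{i=1}^k\delta_{x_i}$ and $\hat\tau_z\mathbf x=(z+x_1,\dots,z+x_k)$. For a Schwartz function $\varphi\in\mathcal S(\mathbb R^d)$ and an integer $N\ge 1$ the $k$-th order polynomial fluctuation field is $$X_N(\mathbf x,\eta,\varphi)=\sum_{z\in\mathbb Z^d}\varphi\!\left(\tfrac zN\right)D\big(\xi(\hat\tau_z\mathbf x),\eta\big).$$ **Theorem 3.4 (quantitative Boltzmann–Gibbs principle).** Fix $d,k,p,\rho,\mathbf x,\varphi$ as above. For every $N\ge1$ and $t,s\ge 0$ the series defining $X_N(\mathbf x,\eta(t),\varphi)$ converges absolutely almost surely, the product $X_N(\mathbf x,\eta(t),\varphi)\,X_N(\mathbf x,\eta(s),\varphi)$ is integrable, and for every $T>0$ the function $(t,s)\mapsto\mathbb E_{\nu_\rho}[X_N(\mathbf x,\eta(N^2t),\varphi)\,X_N(\mathbf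 x,\eta(N^2s),\varphi)]$ is integrable on $[0,T]^2$. Moreover, for every $T>0$ there is a constant $C(T)$ such that for all $N$ large enough $$\frac1{N^d}\int_0^T\!\!\int_0^T\mathbb E_{\nu_\rho}\big[X_N(\mathbf x,\eta(N^2t),\varphi)\,X_N(\mathbf x,\eta(N^2s),\varphi)\big]\,ds\,dt\;\le\;C(T)\,N^{-\frac{2(k-1)d}{2+(k-1)d}}.$$ -/

import Mathlib

open MeasureTheory ProbabilityTheory Filter Topology
open scoped NNReal ENNReal SchwartzMap

namespace BGP

/-- Sites of the lattice `ℤ^d`. -/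
abbrev Site (d : ℕ) : Type := Fin d → ℤ

/-- Particle configurations: `η u` is the number of particles at the site `u`. -/
abbrev Config (d : ℕ) : Type := Site d → ℕ

/-- `p` is a translation invariant, symmetric, finite range, irreducible Markov transition function
on `ℤ^d`. (The norm on `Site d` is the sup norm; this does not affect the notion of
finite range.) -/
structure IsTransition {d : ℕ} (p : Site d → Site d → ℝ) : Prop where
  nonneg : ∀ i j, 0 ≤ p i j
  symm : ∀ i j, p i j = p j i
  translation : ∀ i j, p i j = p 0 (j - i)
  sum_one : ∀ i, HasSum (fun j => p i j) 1
  finite_range : ∃ R : ℝ, 0 < R ∧ ∀ i j, R < ‖i - j‖ → p i j = 0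
  irreducible : ∀ x y, Relation.ReflTransGen (fun i j => 0 < p i j) x y

open scoped Classical in
/-- The `n`-step transition probabilities of the discrete-time chain with transition function
`p`. -/
noncomputable def stepProb {d : ℕ} (p : Site d → Site d → ℝ) : ℕ → Site d → Site d → ℝ
  | 0, x, y => if x = y then 1 else 0
  | n + 1, x, y => ∑' z, p x z * stepProb p n z y

/-- The transition probabilities `p_t(x, y)`, `t ≥ 0`, of the continuous-time random walk which
jumps from `i` to `j` at rate `p i j`, that is `p_t = exp (t (p - 1))`: the number of jumps up to
time `t` is Poisson with mean `t`. -/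
noncomputable def walkProb {d : ℕ} (p : Site d → Site d → ℝ) (t : ℝ) (x y : Site d) : ℝ :=
  ∑' n : ℕ, Real.exp (-t) * t ^ n / (n.factorial : ℝ) * stepProb p n x y

/-- `Y` (indexed by the times `t ≥ 0`) is a continuous-time random walk started at `x` which jumps
from `i` to `j` at rate `p i j`: the Markov chain with transition probabilities `walkProb p`, given
by its finite dimensional distributions. -/
structure IsWalk {d : ℕ} {Ω : Type*} [MeasurableSpace Ω] (P : Measure Ω)
    (p : Site d → Site d → ℝ) (x : Site d) (Y : ℝ → Ω → Site d) : Prop where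
  measurable : ∀ t, 0 ≤ t → Measurable (Y t)
  fdd : ∀ (m : ℕ) (t : ℕ → ℝ) (y : ℕ → Site d), Monotone t → t 0 = 0 → y 0 = x →
    P {ω | ∀ i ≤ m, Y (t i) ω = y i} =
      ENNReal.ofReal (∏ i ∈ Finset.range m, walkProb p (t (i + 1) - t i) (y i) (y (i + 1)))

/-- The product measure `ν_ρ` on configurations with Poisson marginals of parameter `ρ`. -/
noncomputable def poissonField (d : ℕ) (ρ : ℝ≥0) : Measure (Config d) :=
  Measure.infinitePi (fun _ : Site d => poissonMeasure ρ)

/-- The configuration at time `t` of the particles which start from the configuration `init`,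
the `i`-th particle (`i = 0, …, init u - 1`) of the site `u` following the path `Y (u, i)`. -/
noncomputable def configAt {d : ℕ} {Ω : Type*} (init : Ω → Config d)
    (Y : Site d × ℕ → ℝ → Ω → Site d) (t : ℝ) (ω : Ω) : Config d :=
  fun z => Set.ncard {q : Site d × ℕ | q.2 < init ω q.1 ∧ Y q t ω = z}

/-- `η` (indexed by the times `t ≥ 0`) is the system of independent random walkers started from
`ν_ρ`: the initial configuration has law `ν_ρ` and, independently of it, all
particles perform independent continuous-time random walks. Since each particle jumps from `i` to
`j` at rate `p i j`, this is the Markov process with generator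
`L f(η) = ∑_{i,j} p(i,j) η_i (f(η^{ij}) - f(η))` and initial law `ν_ρ`. -/
def IsIRW {d : ℕ} {Ω : Type*} [MeasurableSpace Ω] (P : Measure Ω)
    (p : Site d → Site d → ℝ) (ρ : ℝ≥0) (η : ℝ → Ω → Config d) : Prop :=
  ∃ (init : Ω → Config d) (Y : Site d × ℕ → ℝ → Ω → Site d),
    Measurable init ∧
    P.map init = poissonField d ρ ∧
    (∀ q, IsWalk P p q.1 (Y q)) ∧
    iIndepFun (fun (q : Site d × ℕ) (ω : Ω) (t : ℝ≥0) => Y q t ω) P ∧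
    IndepFun init (fun (ω : Ω) (q : Site d × ℕ) (t : ℝ≥0) => Y q t ω) P ∧
    ∀ t, 0 ≤ t → ∀ ω, η t ω = configAt init Y t ω

/-- The single-site Charlier polynomial
`d(k, n) = ₂F₀(-k, -n; ; -1/ρ) = ∑_{j ≤ k} (k choose j) (-ρ)^{-j} n! / (n - j)!`
(the falling factorial vanishes for `j > n`). -/
noncomputable def charlier (ρ : ℝ≥0) (k n : ℕ) : ℝ :=
  ∑ j ∈ Finset.range (k + 1),
    (k.choose j : ℝ) * ((-(ρ : ℝ))⁻¹) ^ j * (n.descFactorial j : ℝ)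

/-- The orthogonal polynomial `D(ξ, η) = ∏_u d(ξ_u, η_u)`, for `ξ` with finitely many particles
(all factors with `ξ_u = 0` are equal to `1`). -/
noncomputable def dualPoly {d : ℕ} (ρ : ℝ≥0) (ξ η : Config d) : ℝ :=
  ∏ᶠ u : Site d, charlier ρ (ξ u) (η u)

/-- The configuration `ξ(x)` of `k` labelled particles at `x_1, …, x_k`. -/
noncomputable def toConfig {d k : ℕ} (x : Fin k → Site d) : Config d :=
  fun u => Nat.card {i : Fin k // x i = u}

/-- The shift of a coordinate vector: `(z + x_1, …, z + x_k)`. -/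
def shift {d k : ℕ} (z : Site d) (x : Fin k → Site d) : Fin k → Site d :=
  fun i => z + x i

/-- The point `z / N` of `ℝ^d`. -/
noncomputable def scaled {d : ℕ} (N : ℕ) (z : Site d) : EuclideanSpace ℝ (Fin d) :=
  WithLp.toLp 2 (fun i => (z i : ℝ) / (N : ℝ))

/-- The summand `φ(z/N) D(ξ(z + x), η)` of the `k`-th order fluctuation field. -/
noncomputable def fieldTerm {d k : ℕ} (ρ : ℝ≥0) (φ : 𝓢(EuclideanSpace ℝ (Fin d), ℝ)) (N : ℕ)
    (x : Fin k → Site d) (η : Config d) (z : Site d) : ℝ :=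
  φ (scaled N z) * dualPoly ρ (toConfig (shift z x)) η

/-- The `k`-th order fluctuation field `X_N(x, η, φ) = ∑_z φ(z/N) D(ξ(z + x), η)`. -/
noncomputable def field {d k : ℕ} (ρ : ℝ≥0) (φ : 𝓢(EuclideanSpace ℝ (Fin d), ℝ)) (N : ℕ)
    (x : Fin k → Site d) (η : Config d) : ℝ :=
  ∑' z : Site d, fieldTerm ρ φ N x η z

/-- The stationary two-time correlation `E_{ν_ρ}[X_N(x, η(N² t), φ) X_N(x, η(N² s), φ)]`. -/
noncomputable def correlation {d k : ℕ} {Ω : Type*} [MeasurableSpace Ω] (P : Measure Ω)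
    (ρ : ℝ≥0) (η : ℝ → Ω → Config d) (φ : 𝓢(EuclideanSpace ℝ (Fin d), ℝ)) (N : ℕ)
    (x : Fin k → Site d) (t s : ℝ) : ℝ :=
  ∫ ω, field ρ φ N x (η ((N : ℝ) ^ 2 * t) ω) * field ρ φ N x (η ((N : ℝ) ^ 2 * s) ω) ∂P

end BGP

namespace BGP

/-! ### Combinatorics of lists -/

/-! The key is self-duality with orthogonal polynomials. For labelled points `x`, `y`, the
expectation of `D(ξ(x), η(t)) D(ξ(y), η(s))` is the sum over bijections between the two families of
the products of `ρ⁻¹ p_{|t-s|}(x_i, y_j)`, a permanent of the heat kernel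
(`IsIRW.integral_dualPoly_mul`).

Duality comes from Poisson statistics, not from the generator. The particles, each marked by its
positions at the two times, form a Poisson field with independent marks. The Mecke formula
(`IsMarkedField.lintegral_tupleSum`) then gives the joint factorial moments of the occupation
numbers as sums over partial matchings: `ρ p_{|t-s|}(x, y)` for a matched pair, `ρ` for an unmatched
point. A Charlier product is the signed sum, with weight `(-ρ)⁻¹` per point, of the factorial
products over sublists of `x` (`dualPoly_eq_sublistSum`). Under this transform an unmatched point
gets total weight `1 + (-ρ)⁻¹ρ = 0`, so only the perfect matchings survive
(`sublistSum_jointMoment`).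

The correlation of the field is thus a double sum over `z, w` of `φ(z/N) φ(w/N)` times a nonnegative
permanent. Bounding `k - 1` of the `k` kernel factors by a uniform bound `b` and summing the last
one over `w` to total mass `1` gives a bound of order `N^d b^(k-1)` (`IsIRW.abs_field_mul_le`). One
may take `b = 1`, or `b = A u^(-d/2)` at time lag `u > 0` by the heat kernel estimate
(`IsTransition.exists_walkProb_le`), proved by Fourier inversion and a quadratic lower bound on `1 -
stepChar`.

After diffusive scaling the lag is `N²|t-s|`. The strip `|t-s| ≤ ε` contributes order `N^d ε`, its
complement order `N^d (N²ε)^(-(k-1)d/2)`. Equating the two gives `ε = N^(-2(k-1)d/(2+(k-1)d))`, the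
stated rate. -/

/-- The sum of `Ψ y l` over all ways to take one element `y` out of a list, leaving `l`. -/
def pick {α M : Type*} [AddCommMonoid M] : List α → (α → List α → M) → M
  | [], _ => 0
  | y :: ys, Ψ => Ψ y ys + pick ys (fun a l => Ψ a (y :: l))

/-- The sum of `r ^ |l| * Φ l` over all sublists `l` of a list. -/
def sublistSum {α : Type*} (r : ℝ) : List α → (List α → ℝ) → ℝ
  | [], Φ => Φ []
  | a :: l, Φ => sublistSum r l Φ + r * sublistSum r l (fun m => Φ (a :: m))

section pick

variable {α β M M' : Type*} [AddCommMonoid M] [AddCommMonoid M']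

lemma pick_add (ys : List α) (Ψ Ψ' : α → List α → M) :
    pick ys (fun y l => Ψ y l + Ψ' y l) = pick ys Ψ + pick ys Ψ' := by
  induction ys generalizing Ψ Ψ' with
  | nil => simp [pick]
  | cons y ys ih => simp only [pick, ih]; exact add_add_add_comm _ _ _ _

lemma map_pick (f : M →+ M') (ys : List α) (Ψ : α → List α → M) :
    f (pick ys Ψ) = pick ys (fun y l => f (Ψ y l)) := by
  induction ys generalizing Ψ with
  | nil => simp [pick]
  | cons y ys ih => simp [pick, ih]

lemma pick_apply {γ : Type*} (ys : List α) (Ψ : α → List α → γ → M) (c : γ) :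
    pick ys Ψ c = pick ys (fun y l => Ψ y l c) :=
  map_pick (Pi.evalAddMonoidHom (fun _ : γ => M) c) ys Ψ

lemma pick_congr {ys : List α} {Ψ Ψ' : α → List α → M}
    (h : ∀ y l, l.length + 1 = ys.length → Ψ y l = Ψ' y l) : pick ys Ψ = pick ys Ψ' := by
  induction ys generalizing Ψ Ψ' with
  | nil => rfl
  | cons y ys ih =>
    simp only [pick]
    rw [h y ys (by simp), ih (fun a l hl => h a (y :: l) (by simp [hl]))]

lemma pick_map (f : β → α) (ys : List β) (Ψ : α → List α → M) :
    pick (ys.map f) Ψ = pick ys (fun y l => Ψ (f y) (l.map f)) := by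
  induction ys generalizing Ψ with
  | nil => simp [pick]
  | cons y ys ih => simp [pick, ih]

lemma mul_pick {R : Type*} [NonUnitalNonAssocSemiring R] (c : R) (ys : List α)
    (Ψ : α → List α → R) : c * pick ys Ψ = pick ys (fun y l => c * Ψ y l) :=
  map_pick (AddMonoidHom.mulLeft c) ys Ψ

lemma pick_const_left (ys : List α) (f : α → M) :
    pick ys (fun y _ => f y) = (ys.map f).sum := by
  induction ys with
  | nil => simp [pick]
  | cons y ys ih => simp [pick, ih]

lemma pick_mono {ys : List α} {Ψ Ψ' : α → List α → ℝ}
    (h : ∀ y l, l.length + 1 = ys.length → Ψ y l ≤ Ψ' y l) : pick ys Ψ ≤ pick ys Ψ' := by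
  induction ys generalizing Ψ Ψ' with
  | nil => simp [pick]
  | cons y ys ih =>
    simp only [pick]
    exact add_le_add (h y ys (by simp)) (ih (fun a l hl => h a (y :: l) (by simp [hl])))

end pick

section sublistSum

variable {α : Type*} {r : ℝ}

lemma sublistSum_add (xs : List α) (Φ Φ' : List α → ℝ) :
    sublistSum r xs (fun l => Φ l + Φ' l) = sublistSum r xs Φ + sublistSum r xs Φ' := by
  induction xs generalizing Φ Φ' with
  | nil => simp [sublistSum]
  | cons y ys ih => simp only [sublistSum, ih]; ring

lemma sublistSum_mul (xs : List α) (c : ℝ) (Φ : List α → ℝ) :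
    sublistSum r xs (fun l => c * Φ l) = c * sublistSum r xs Φ := by
  induction xs generalizing Φ with
  | nil => simp [sublistSum]
  | cons y ys ih => simp only [sublistSum, ih]; ring

lemma sublistSum_pick_comm {β : Type*} (xs : List α) (ys : List β)
    (Φ : List α → β → List β → ℝ) :
    sublistSum r xs (fun l => pick ys (Φ l)) =
      pick ys (fun y m => sublistSum r xs (fun l => Φ l y m)) := by
  induction xs generalizing Φ with
  | nil => simp [sublistSum]
  | cons x xs ih => simp only [sublistSum, ih, pick_add, mul_pick]

/-- Choosing a sublist and then one of its elements amounts to choosing the element first, with its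
factor `r`, and then a sublist of what remains of `ys`. -/
lemma sublistSum_pick (ys : List α) (Ψ : α → List α → ℝ) :
    sublistSum r ys (fun l => pick l Ψ) =
      r * pick ys (fun y l => sublistSum r l (Ψ y)) := by
  induction ys generalizing Ψ with
  | nil => simp [sublistSum, pick]
  | cons y ys ih =>
    simp only [sublistSum, pick, ih, sublistSum_add, pick_add]
    rw [← mul_pick]
    ring

end sublistSum

/-- The joint factorial moments of two Poisson fields with intensity `ρ` and correlation kernel
`K`, at sites listed with multiplicity. -/
def jointMoment {α R : Type*} [CommSemiring R] (ρ : R) (K : α → α → R) :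
    List α → List α → R
  | [], ys => ρ ^ ys.length
  | x :: xs, ys => ρ * jointMoment ρ K xs ys +
      pick ys (fun y l => ρ * K x y * jointMoment ρ K xs l)

/-- The sum of `∏ c * K x y` over the bijections `x ↦ y` between two lists. -/
def matchSum {α : Type*} (c : ℝ) (K : α → α → ℝ) : List α → List α → ℝ
  | [], [] => 1
  | [], _ :: _ => 0
  | x :: xs, ys => c * pick ys (fun y l => K x y * matchSum c K xs l)

lemma map_jointMoment {α R R' : Type*} [CommSemiring R] [CommSemiring R'] (f : R →+* R') (ρ : R)
    (K : α → α → R) (xs ys : List α) :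
    f (jointMoment ρ K xs ys) = jointMoment (f ρ) (fun x y => f (K x y)) xs ys := by
  induction xs generalizing ys with
  | nil => simp [jointMoment]
  | cons x xs ih =>
    simp only [jointMoment, map_add, map_mul, ih]
    congr 1
    exact (map_pick f.toAddMonoidHom ys _).trans (by simp [ih])

/-- The Charlier transform in both arguments turns joint factorial moments into a matching sum. -/
lemma sublistSum_jointMoment {α : Type*} {ρ : ℝ} (hρ : ρ ≠ 0) (K : α → α → ℝ) (xs ys : List α) :
    sublistSum (-ρ)⁻¹ ys (fun m => sublistSum (-ρ)⁻¹ xs (fun l => jointMoment ρ K l m)) =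
      matchSum ρ⁻¹ K xs ys := by
  -- The cancellation behind orthogonality: keeping a point unmatched costs `(-ρ)⁻¹ρ = -1`, omitting
  -- it costs `1`.
  have hr : (-ρ)⁻¹ * ρ = -1 := by field_simp
  induction xs generalizing ys with
  | nil =>
    simp only [sublistSum, jointMoment]
    cases ys with
    | nil => simp [sublistSum, matchSum]
    | cons y ys =>
      simp only [sublistSum, matchSum, List.length_cons, pow_succ']
      rw [sublistSum_mul, ← mul_assoc, hr]
      ring
  | cons x xs ih =>
    -- Omitting `x` cancels against keeping it unmatched. What remains matches `x` with some `y`,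
    -- with weight `(-ρ)⁻¹ρ K x y = -K x y`; the transform in `ys` later supplies the factor
    -- `(-ρ)⁻¹` of `y`.
    have h1 : ∀ m, sublistSum (-ρ)⁻¹ (x :: xs) (fun l => jointMoment ρ K l m) =
        pick m (fun y l => -K x y * sublistSum (-ρ)⁻¹ xs (fun l' => jointMoment ρ K l' l)) := by
      intro m
      simp only [sublistSum, jointMoment]
      rw [sublistSum_add, sublistSum_mul, sublistSum_pick_comm, mul_add, ← mul_assoc, hr, mul_pick]
      rw [neg_one_mul, ← add_assoc, add_neg_cancel, zero_add]
      refine pick_congr fun y l _ => ?_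
      rw [sublistSum_mul, ← mul_assoc, ← mul_assoc, hr]
      ring
    simp only [h1]
    rw [sublistSum_pick]
    simp only [matchSum, mul_pick]
    refine pick_congr fun y l _ => ?_
    rw [sublistSum_mul, ih, inv_neg]
    ring

/-! ### Bounds for matching sums -/

section bounds

variable {α : Type*} {c b : ℝ} {K : α → α → ℝ}

lemma matchSum_nonneg (hc : 0 ≤ c) (hK : ∀ x y, 0 ≤ K x y) (xs ys : List α) :
    0 ≤ matchSum c K xs ys := by
  induction xs generalizing ys with
  | nil => cases ys <;> simp [matchSum]
  | cons x xs ih =>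
    simp only [matchSum]
    refine mul_nonneg hc ?_
    refine le_trans (le_of_eq ?_) (pick_mono (Ψ := fun _ _ => 0)
      fun y l _ => mul_nonneg (hK x y) (ih l))
    simp [pick_const_left]

/-- Each element of `xs` has at most `n` partners, each of weight at most `c * b`. -/
lemma matchSum_le (hc : 0 ≤ c) (hb : 0 ≤ b) (hK : ∀ x y, 0 ≤ K x y) (hKb : ∀ x y, K x y ≤ b)
    (n : ℕ) (xs ys : List α) (hys : ys.length ≤ n) :
    matchSum c K xs ys ≤ (c * b * n) ^ xs.length := by
  induction xs generalizing ys with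
  | nil => cases ys <;> simp [matchSum]
  | cons x xs ih =>
    simp only [matchSum, List.length_cons]
    calc c * pick ys (fun y l => K x y * matchSum c K xs l)
        ≤ c * pick ys (fun _ _ => b * (c * b * n) ^ xs.length) := by
          gcongr
          refine pick_mono fun y l hl => ?_
          exact mul_le_mul (hKb x y) (ih l (by omega)) (matchSum_nonneg hc hK _ _) hb
      _ = ys.length * (c * b * (c * b * n) ^ xs.length) := by
          rw [pick_const_left]; simp; ring
      _ ≤ n * (c * b * (c * b * n) ^ xs.length) := by gcongr
      _ = _ := by ring

/-- Only the factors after the first are replaced by their uniform bound; the factor of `x` stays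
exact so that it can later be summed over space. -/
lemma matchSum_cons_le (hc : 0 ≤ c) (hb : 0 ≤ b) (hK : ∀ x y, 0 ≤ K x y)
    (hKb : ∀ x y, K x y ≤ b) (x : α) (xs ys : List α) :
    matchSum c K (x :: xs) ys ≤
      c * (c * b * ys.length) ^ xs.length * (ys.map (K x)).sum := by
  simp only [matchSum]
  rw [mul_assoc]
  refine mul_le_mul_of_nonneg_left ?_ hc
  rw [← pick_const_left, mul_pick]
  refine pick_mono fun y l hl => ?_
  rw [mul_comm]
  exact mul_le_mul_of_nonneg_right (matchSum_le hc hb hK hKb _ _ _ (by omega)) (hK x y)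

end bounds

/-! ### Sums over tuples of distinct particles -/

section tupleSum

variable {Q α σ : Type*} [DecidableEq Q]

/-- The sum over the tuples of distinct elements of `Q` outside of `B`, with one entry for each
element of a list, of the product of the weights `H` times a function of the enlarged set. -/
noncomputable def tupleSum (H : α → Q → ℝ≥0∞) :
    List α → (Finset Q → ℝ≥0∞) → Finset Q → ℝ≥0∞
  | [], T, B => T B
  | a :: l, T, B => ∑' q, if q ∈ B then 0 else H a q * tupleSum H l T (insert q B)

variable {H : α → Q → ℝ≥0∞}

lemma tupleSum_append (l m : List α) (T : Finset Q → ℝ≥0∞) :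
    tupleSum H (l ++ m) T = tupleSum H l (tupleSum H m T) := by
  induction l with
  | nil => rfl
  | cons a l ih => funext B; simp [tupleSum, ih]

lemma tupleSum_add (l : List α) (T T' : Finset Q → ℝ≥0∞) :
    tupleSum H l (T + T') = tupleSum H l T + tupleSum H l T' := by
  induction l with
  | nil => rfl
  | cons a l ih =>
    funext B
    simp only [tupleSum, ih, Pi.add_apply]
    rw [← ENNReal.tsum_add]
    refine tsum_congr fun q => ?_
    split_ifs <;> simp [mul_add]

lemma tupleSum_zero (l : List α) : tupleSum H l (0 : Finset Q → ℝ≥0∞) = 0 := by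
  induction l with
  | nil => rfl
  | cons a l ih => funext B; simp [tupleSum, ih]

lemma tupleSum_pick {β : Type*} (l : List α) (ys : List β)
    (Ψ : β → List β → Finset Q → ℝ≥0∞) :
    tupleSum H l (pick ys Ψ) = pick ys (fun y m => tupleSum H l (Ψ y m)) :=
  map_pick (⟨⟨tupleSum H l, tupleSum_zero l⟩, tupleSum_add l⟩ :
    (Finset Q → ℝ≥0∞) →+ (Finset Q → ℝ≥0∞)) ys Ψ

lemma tupleSum_map {β : Type*} (f : β → α) (l : List β) (T : Finset Q → ℝ≥0∞) :
    tupleSum H (l.map f) T = tupleSum (fun b => H (f b)) l T := by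
  induction l with
  | nil => rfl
  | cons a l ih => funext B; simp [tupleSum, ih]

omit [DecidableEq Q] in
lemma tsum_pick (zs : List α) (F : α → List α → Q → ℝ≥0∞) :
    ∑' r, pick zs (fun z l => F z l r) = pick zs (fun z l => ∑' r, F z l r) := by
  induction zs generalizing F with
  | nil => simp [pick]
  | cons z zs ih => simp only [pick]; rw [ENNReal.tsum_add, ih (fun a l => F a (z :: l))]

/-- A tuple of distinct particles either avoids `q` or uses it in exactly one entry `y`. -/
lemma tupleSum_eq_insert_add (ys : List α) {B : Finset Q} {q : Q} (hq : q ∉ B) :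
    tupleSum H ys 1 B = tupleSum H ys 1 (insert q B) +
      pick ys (fun y l => H y q * tupleSum H l 1 (insert q B)) := by
  induction ys generalizing B with
  | nil => simp [tupleSum, pick]
  | cons y ys ih =>
    simp only [tupleSum, pick]
    -- Split on the first entry `r`: if it is `q`, the others avoid `q`; otherwise the induction
    -- hypothesis applies to them with `r` excluded as well.
    have h1 : ∀ r, (if r ∈ B then 0 else H y r * tupleSum H ys 1 (insert r B)) =
        (if r = q then H y q * tupleSum H ys 1 (insert q B) else 0) +
        ((if r ∈ insert q B then 0 else H y r * tupleSum H ys 1 (insert r (insert q B))) +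
          pick ys (fun z l => H z q *
            (if r ∈ insert q B then 0 else H y r * tupleSum H l 1 (insert r (insert q B))))) := by
      intro r
      by_cases hr : r = q
      · subst hr
        simp [hq, pick_const_left]
      · by_cases hrB : r ∈ B
        · simp [hr, hrB, pick_const_left]
        · simp only [hr, hrB, if_false, Finset.mem_insert, or_self, zero_add]
          rw [ih (B := insert r B) (by simp [hq, Ne.symm hr]), mul_add, mul_pick,
            Finset.insert_comm r q B]
          congr 1
          exact pick_congr fun z l _ => by ring
    simp only [h1]
    rw [ENNReal.tsum_add, ENNReal.tsum_add, tsum_ite_eq]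
    rw [tsum_pick]
    simp only [ENNReal.tsum_mul_left]
    ring

/-- The particle `q` serving `x` is either absent from the second tuple or serves one entry `y`
there, in which case the two weights merge into that of `x * y`. The recursion has the shape of
`jointMoment`. -/
lemma tupleSum_mul_tupleSum [Mul α] (hH : ∀ a b q, H (a * b) q = H a q * H b q) (x : α)
    (xs ys : List α) :
    tupleSum H (x :: xs) 1 * tupleSum H ys 1 =
      tupleSum H [x] (tupleSum H xs 1 * tupleSum H ys 1) +
        pick ys (fun y l => tupleSum H [x * y] (tupleSum H xs 1 * tupleSum H l 1)) := by
  funext B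
  rw [Pi.add_apply, pick_apply]
  simp only [tupleSum, Pi.mul_apply]
  rw [← tsum_pick, ← ENNReal.tsum_add, ← ENNReal.tsum_mul_right]
  refine tsum_congr fun q => ?_
  by_cases hq : q ∈ B
  · simp [hq, pick_const_left]
  · simp only [hq, if_false]
    rw [tupleSum_eq_insert_add ys hq, mul_add, mul_pick, mul_assoc]
    congr 1
    exact pick_congr fun y l _ => by rw [hH]; ring

end tupleSum

/-! ### Tuple sums which depend only on types of particles -/

section types

variable {Q α σ : Type*} [DecidableEq Q] [DecidableEq σ]

/-- The tuple sum of weights which depend on the types only, for `n u - c u` available particles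
of each type `u`. -/
noncomputable def typeSum (e : α → σ → ℝ≥0∞) (n : σ → ℕ) : List α → (σ → ℕ) → ℝ≥0∞
  | [], _ => 1
  | a :: l, c => ∑' u, e a u * ((n u - c u : ℕ) : ℝ≥0∞) * typeSum e n l (c + Pi.single u 1)

/-- The product of the falling factorials `n u (n u - 1) ⋯ (n u - c u + 1)`. -/
noncomputable def factProd (n c : σ → ℕ) : ℕ := ∏ᶠ u, (n u).descFactorial (c u)

omit [DecidableEq σ] in
lemma factProd_zero (n : σ → ℕ) : factProd n 0 = 1 := by simp [factProd]

lemma factProd_eq_prod (n c : σ → ℕ) (s : Finset σ) (hs : ∀ u ∉ s, c u = 0) :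
    factProd n c = ∏ u ∈ s, (n u).descFactorial (c u) := by
  refine finprod_eq_prod_of_mulSupport_subset _ fun u hu => ?_
  by_contra h
  exact hu (by simp [hs u h])

/-- Truncated subtraction is harmless: once `n u ≤ c u`, both sides vanish. -/
lemma factProd_add_single (n : σ → ℕ) {c : σ → ℕ} (hc : c.support.Finite) (u : σ) :
    factProd n (c + Pi.single u 1) = (n u - c u) * factProd n c := by
  set s := insert u hc.toFinset
  rw [factProd_eq_prod n c s (fun v hv => by simp [s] at hv; tauto),
    factProd_eq_prod n _ s (fun v hv => by simp [s] at hv; simp [hv]),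
    ← Finset.mul_prod_erase s _ (Finset.mem_insert_self u _),
    ← Finset.mul_prod_erase s _ (Finset.mem_insert_self u _), ← mul_assoc]
  congr 1
  · simp [Nat.descFactorial_succ]
  · exact Finset.prod_congr rfl fun v hv => by simp [Finset.ne_of_mem_erase hv]

lemma support_add_single_finite {c : σ → ℕ} (hc : c.support.Finite) (u : σ) :
    (c + Pi.single u 1).support.Finite :=
  (hc.union (Set.finite_singleton u)).subset fun v hv => by
    by_cases h : v = u
    · simp [h]
    · left; simpa [h] using hv

/-- The sum over types of the products of weights times falling factorials. -/
noncomputable def factSum (e : α → σ → ℝ≥0∞) (n : σ → ℕ) : List α → (σ → ℕ) → ℝ≥0∞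
  | [], c => factProd n c
  | a :: l, c => ∑' u, e a u * factSum e n l (c + Pi.single u 1)

/-- The factors `n u - c u` met along the list are absorbed one by one into the falling factorials.
-/
lemma factProd_mul_typeSum (e : α → σ → ℝ≥0∞) (n : σ → ℕ) (l : List α) {c : σ → ℕ}
    (hc : c.support.Finite) : (factProd n c : ℝ≥0∞) * typeSum e n l c = factSum e n l c := by
  induction l generalizing c with
  | nil => simp [typeSum, factSum]
  | cons a l ih =>
    simp only [typeSum, factSum]
    rw [← ENNReal.tsum_mul_left]
    refine tsum_congr fun u => ?_
    rw [← ih (support_add_single_finite hc u), factProd_add_single n hc u]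
    push_cast
    ring

omit [DecidableEq Q] [DecidableEq σ] in
-- Summation fibre by fibre. Finiteness is needed because `Set.ncard` is zero on infinite sets.
lemma tsum_indicator_comp (E : Set Q) (τ : Q → σ) (G : σ → ℝ≥0∞)
    (hfin : ∀ u, {q | q ∈ E ∧ τ q = u}.Finite) :
    ∑' q, E.indicator (fun q => G (τ q)) q =
      ∑' u, G u * (Set.ncard {q | q ∈ E ∧ τ q = u} : ℝ≥0∞) := by
  rw [← (Equiv.sigmaFiberEquiv τ).tsum_eq, ENNReal.tsum_sigma']
  refine tsum_congr fun u => ?_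
  have h1 : ∀ b : {q // τ q = u}, E.indicator (fun q => G (τ q))
      ((Equiv.sigmaFiberEquiv τ) ⟨u, b⟩) =
      G u * ({q | q ∈ E ∧ τ q = u}.indicator (fun _ => (1 : ℝ≥0∞)) b) := by
    rintro ⟨b, hb⟩
    by_cases h : b ∈ E <;> simp [Equiv.sigmaFiberEquiv, h, hb]
  simp only [h1]
  rw [ENNReal.tsum_mul_left]
  congr 1
  refine (tsum_subtype {q | τ q = u}
    ({q | q ∈ E ∧ τ q = u}.indicator (fun _ => (1 : ℝ≥0∞)))).trans ?_
  rw [Set.indicator_indicator, Set.inter_eq_right.2 (fun q hq => hq.2),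
    ← tsum_subtype, ENNReal.tsum_set_one, ← (hfin u).cast_ncard_eq]
  simp

/-- Since the weights see only types, the next entry, if of type `u`, can be any of the particles of
type `u` not yet in `B`. -/
lemma tupleSum_eq_typeSum {H : α → Q → ℝ≥0∞} {E : Set Q} {τ : Q → σ} {e : α → σ → ℝ≥0∞}
    (hH : ∀ a q, H a q = E.indicator (fun q => e a (τ q)) q)
    (hfin : ∀ u, {q | q ∈ E ∧ τ q = u}.Finite) (l : List α) {B : Finset Q} (hB : ↑B ⊆ E) :
    tupleSum H l 1 B = typeSum e (fun u => Set.ncard {q | q ∈ E ∧ τ q = u}) l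
      (fun u => (B.filter (fun q => τ q = u)).card) := by
  induction l generalizing B with
  | nil => rfl
  | cons a l ih =>
    simp only [tupleSum, typeSum]
    set c : σ → ℕ := fun u => (B.filter (fun q => τ q = u)).card with hc
    set n : σ → ℕ := fun u => Set.ncard {q | q ∈ E ∧ τ q = u} with hn
    have h1 : ∀ q, (if q ∈ B then 0 else H a q * tupleSum H l 1 (insert q B)) =
        (E \ B).indicator (fun q => e a (τ q) * typeSum e n l (c + Pi.single (τ q) 1)) q := by
      intro q
      by_cases hqB : q ∈ B
      · simp [hqB]
      by_cases hqE : q ∈ E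
      · simp only [hqB, if_false, hH, hqE, Set.indicator_of_mem, Set.mem_sdiff,
          Finset.mem_coe, not_false_eq_true, and_self]
        rw [ih (B := insert q B) (by
          rw [Finset.coe_insert]; exact Set.insert_subset hqE hB)]
        congr 2
        funext u
        by_cases hu : τ q = u
        · subst hu
          simp [hc, Finset.filter_insert, hqB]
        · simp [hc, Finset.filter_insert, hu, Ne.symm hu]
      · simp [hqB, hH, hqE]
    simp only [h1]
    refine (tsum_indicator_comp (E \ B) τ
      (fun u => e a u * typeSum e n l (c + Pi.single u 1))
      (fun u => (hfin u).subset fun q hq => ⟨hq.1.1, hq.2⟩)).trans ?_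
    refine tsum_congr fun u => ?_
    have h2 : Set.ncard {q | q ∈ E \ ↑B ∧ τ q = u} = n u - c u := by
      have : {q | q ∈ E \ ↑B ∧ τ q = u} =
          {q | q ∈ E ∧ τ q = u} \ ↑(B.filter (fun q => τ q = u)) := by
        ext q; simp; tauto
      rw [this, Set.ncard_sdiff (fun q hq => by
        simp at hq; exact ⟨hB hq.1, hq.2⟩) (Finset.finite_toSet _), Set.ncard_coe_finset]
    rw [h2]
    ring

/-- Used with two notions of type: the starting site, for the Mecke formula, and the position at a
given time, for the occupation numbers. -/
lemma tupleSum_empty {H : α → Q → ℝ≥0∞} {E : Set Q} {τ : Q → σ} {e : α → σ → ℝ≥0∞}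
    (hH : ∀ a q, H a q = E.indicator (fun q => e a (τ q)) q)
    (hfin : ∀ u, {q | q ∈ E ∧ τ q = u}.Finite) (l : List α) :
    tupleSum H l 1 ∅ = factSum e (fun u => Set.ncard {q | q ∈ E ∧ τ q = u}) l 0 := by
  rw [tupleSum_eq_typeSum hH hfin l (by simp),
    ← factProd_mul_typeSum e _ l (c := 0) (by simp), factProd_zero]
  simp [Pi.zero_def]

lemma factSum_single (n : σ → ℕ) (l : List σ) (c : σ → ℕ) :
    factSum (fun a u => if u = a then 1 else 0) n l c =
      factProd n (c + fun u => l.count u) := by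
  induction l generalizing c with
  | nil => simp [factSum, Pi.zero_def.symm]
  | cons a l ih =>
    simp only [factSum, ih]
    rw [tsum_eq_single a (by intro b hb; simp [hb])]
    simp only [if_true, one_mul, add_assoc]
    congr 3
    funext u
    by_cases h : u = a
    · subst h; simp [add_comm]
    · simp [h, Ne.symm h]

end types

/-! ### Factorial moments of Poisson fields -/

/-- The shift `n ↦ n + 1` lowers the order of the falling factorial by one and releases a factor `ρ`
from the Poisson weight. -/
lemma lintegral_descFactorial_poissonMeasure (ρ : ℝ≥0) (m : ℕ) :
    ∫⁻ n, (n.descFactorial m : ℝ≥0∞) ∂(poissonMeasure ρ) = (ρ : ℝ≥0∞) ^ m := by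
  have hint : ∀ f : ℕ → ℝ≥0∞, ∫⁻ n, f n ∂(poissonMeasure ρ) =
      ∑' n : ℕ, ENNReal.ofReal (Real.exp (-ρ) * ρ ^ n / n.factorial) * f n := by
    intro f
    rw [poissonMeasure, lintegral_sum_measure]
    simp [lintegral_smul_measure]
  induction m with
  | zero => simp
  | succ m ih =>
    rw [hint, tsum_eq_zero_add' ENNReal.summable, pow_succ', ← ih, hint, ← ENNReal.tsum_mul_left]
    simp only [Nat.zero_descFactorial_succ, Nat.cast_zero, mul_zero, zero_add]
    refine tsum_congr fun n => ?_
    rw [Nat.succ_descFactorial_succ, ← ENNReal.ofReal_natCast, ← ENNReal.ofReal_natCast,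
      ← ENNReal.ofReal_coe_nnreal, ← ENNReal.ofReal_mul (by positivity),
      ← ENNReal.ofReal_mul (by positivity), ← ENNReal.ofReal_mul (by positivity)]
    congr 1
    rw [Nat.factorial_succ]
    push_cast
    field_simp
    ring

lemma measurable_factProd {d : ℕ} {c : Site d → ℕ} (hc : c.support.Finite) :
    Measurable (fun n : Config d => (factProd n c : ℝ≥0∞)) := by
  have h : (fun n : Config d => (factProd n c : ℝ≥0∞)) =
      fun n => ∏ u ∈ hc.toFinset, ((n u).descFactorial (c u) : ℝ≥0∞) := by
    funext n
    rw [factProd_eq_prod n c hc.toFinset (fun v hv => by simpa using hv)]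
    push_cast
    rfl
  rw [h]
  refine Finset.measurable_prod _ fun u _ => ?_
  exact (Measurable.of_discrete (f := fun m : ℕ => (m.descFactorial (c u) : ℝ≥0∞))).comp
    (measurable_pi_apply u)

lemma lintegral_factProd {d : ℕ} (ρ : ℝ≥0) (c : Site d → ℕ) (s : Finset (Site d))
    (hs : ∀ u ∉ s, c u = 0) :
    ∫⁻ n, (factProd n c : ℝ≥0∞) ∂(poissonField d ρ) = (ρ : ℝ≥0∞) ^ ∑ u ∈ s, c u := by
  simp only [factProd_eq_prod _ c s hs, Nat.cast_prod]
  have h := lintegral_prod_eq_prod_lintegral_of_indepFun s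
    (fun (u : Site d) (n : Config d) => ((n u).descFactorial (c u) : ℝ≥0∞))
    (iIndepFun_infinitePi (P := fun _ : Site d => poissonMeasure ρ)
      (X := fun u (m : ℕ) => (m.descFactorial (c u) : ℝ≥0∞)) fun u => Measurable.of_discrete)
    (fun u => (Measurable.of_discrete (f := fun m : ℕ => (m.descFactorial (c u) : ℝ≥0∞))).comp
      (measurable_pi_apply u))
  rw [poissonField, h, ← Finset.prod_pow_eq_pow_sum]
  refine Finset.prod_congr rfl fun u _ => ?_
  have h2 := Measure.infinitePi_map_eval (fun _ : Site d => poissonMeasure ρ) u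
  rw [← lintegral_descFactorial_poissonMeasure, ← h2,
    lintegral_map Measurable.of_discrete (measurable_pi_apply u), h2]

lemma lintegral_factProd_add_single {d : ℕ} (ρ : ℝ≥0) {c : Site d → ℕ} (hc : c.support.Finite)
    (u : Site d) :
    ∫⁻ n, (factProd n (c + Pi.single u 1) : ℝ≥0∞) ∂(poissonField d ρ) =
      ρ * ∫⁻ n, (factProd n c : ℝ≥0∞) ∂(poissonField d ρ) := by
  set s := insert u hc.toFinset
  rw [lintegral_factProd ρ c s (fun v hv => by simp [s] at hv; tauto),
    lintegral_factProd ρ _ s (fun v hv => by simp [s] at hv; simp [hv]), ← pow_succ']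
  congr 1
  simp only [Pi.add_apply, Finset.sum_add_distrib]
  congr 1
  rw [Finset.sum_eq_single u (fun v _ hv => by simp [hv]) (by simp [s]), Pi.single_eq_same]

lemma measurable_factSum {d : ℕ} {α : Type*} (e : α → Site d → ℝ≥0∞) (l : List α)
    {c : Site d → ℕ} (hc : c.support.Finite) :
    Measurable (fun n : Config d => factSum e n l c) := by
  induction l generalizing c with
  | nil => exact measurable_factProd hc
  | cons a l ih =>
    exact Measurable.tsum fun u =>
      (ih (support_add_single_finite hc u)).const_mul _

/-- An additional count always costs a factor `ρ`, whatever the site and the counts already made;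
hence the entries of the list decouple. -/
lemma lintegral_factSum {d : ℕ} {α : Type*} (ρ : ℝ≥0) (e : α → Site d → ℝ≥0∞) (l : List α)
    {c : Site d → ℕ} (hc : c.support.Finite) :
    ∫⁻ n, factSum e n l c ∂(poissonField d ρ) =
      (∫⁻ n, (factProd n c : ℝ≥0∞) ∂(poissonField d ρ)) *
        (l.map (fun a => ρ * ∑' u, e a u)).prod := by
  induction l generalizing c with
  | nil => simp [factSum]
  | cons a l ih =>
    simp only [factSum]
    rw [lintegral_tsum fun u => ((measurable_factSum e l
      (support_add_single_finite hc u)).const_mul _).aemeasurable]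
    have h : ∀ u, ∫⁻ n, e a u * factSum e n l (c + Pi.single u 1) ∂(poissonField d ρ) =
        e a u * (ρ * (∫⁻ n, (factProd n c : ℝ≥0∞) ∂(poissonField d ρ)) *
          (l.map (fun a => ρ * ∑' u, e a u)).prod) := by
      intro u
      rw [lintegral_const_mul _ (measurable_factSum e l (support_add_single_finite hc u)),
        ih (support_add_single_finite hc u), lintegral_factProd_add_single ρ hc u]
    simp only [h]
    rw [ENNReal.tsum_mul_right, List.map_cons, List.prod_cons]
    ring

/-! ### Independently marked Poisson fields -/

/-- The particles `(u, i)`, `i < init u`, of a Poisson field of configurations carry independent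
marks `X (u, i)`, whose law depends on the site `u` only. -/
structure IsMarkedField {d : ℕ} {Ω 𝒳 : Type*} [MeasurableSpace Ω] [MeasurableSpace 𝒳]
    (P : Measure Ω) (ρ : ℝ≥0) (init : Ω → Config d) (X : Site d × ℕ → Ω → 𝒳) : Prop where
  measurable_init : Measurable init
  map_init : P.map init = poissonField d ρ
  measurable : ∀ q, Measurable (X q)
  indep : iIndepFun X P
  indep_init : IndepFun init (fun ω q => X q ω) P
  law : ∀ q (g : 𝒳 → ℝ≥0∞), ∫⁻ ω, g (X q ω) ∂P = ∫⁻ ω, g (X (q.1, 0) ω) ∂P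

/-- The weight of a particle: a function of the mark if the particle exists, zero otherwise. -/
noncomputable def markWeight {d : ℕ} {Ω 𝒳 : Type*} (init : Ω → Config d)
    (X : Site d × ℕ → Ω → 𝒳) (ω : Ω) (g : 𝒳 → ℝ≥0∞) (q : Site d × ℕ) : ℝ≥0∞ :=
  {q : Site d × ℕ | q.2 < init ω q.1}.indicator (fun q => g (X q ω)) q

/-- The intensity measure of the marks, integrated against `g`. -/
noncomputable def markIntensity {d : ℕ} {Ω 𝒳 : Type*} [MeasurableSpace Ω] (P : Measure Ω)
    (X : Site d × ℕ → Ω → 𝒳) (g : 𝒳 → ℝ≥0∞) : ℝ≥0∞ :=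
  ∑' u : Site d, ∫⁻ ω, g (X (u, 0) ω) ∂P

namespace IsMarkedField

variable {d : ℕ} {Ω 𝒳 : Type*} [MeasurableSpace Ω] [MeasurableSpace 𝒳] [DiscreteMeasurableSpace 𝒳]
  {P : Measure Ω} {ρ : ℝ≥0} {init : Ω → Config d} {X : Site d × ℕ → Ω → 𝒳}

omit [MeasurableSpace Ω] [MeasurableSpace 𝒳] [DiscreteMeasurableSpace 𝒳] in
lemma markWeight_eq_mul (g : 𝒳 → ℝ≥0∞) (q : Site d × ℕ) (ω : Ω) :
    markWeight init X ω g q = (if q.2 < init ω q.1 then 1 else 0) * g (X q ω) := by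
  by_cases h : q.2 < init ω q.1 <;> simp [markWeight, h]

omit [MeasurableSpace Ω] [MeasurableSpace 𝒳] [DiscreteMeasurableSpace 𝒳] in
lemma markWeight_mul (ω : Ω) (g g' : 𝒳 → ℝ≥0∞) (q : Site d × ℕ) :
    markWeight init X ω (g * g') q = markWeight init X ω g q * markWeight init X ω g' q := by
  by_cases h : q.2 < init ω q.1 <;> simp [markWeight, h]

omit [MeasurableSpace 𝒳] [DiscreteMeasurableSpace 𝒳] in
lemma measurable_alive (hi : Measurable init) (q : Site d × ℕ) :
    Measurable (fun ω => if q.2 < init ω q.1 then (1 : ℝ≥0∞) else 0) :=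
  (Measurable.of_discrete (f := fun n : ℕ => if q.2 < n then (1 : ℝ≥0∞) else 0)).comp
    ((measurable_pi_apply q.1).comp hi)

lemma measurable_markWeight (h : IsMarkedField P ρ init X) (g : 𝒳 → ℝ≥0∞) (q : Site d × ℕ) :
    Measurable (fun ω => markWeight init X ω g q) := by
  simp only [markWeight_eq_mul]
  exact (measurable_alive h.measurable_init q).mul
    ((Measurable.of_discrete (f := g)).comp (h.measurable q))

lemma measurable_tupleSum {α : Type*} {H : Ω → α → Site d × ℕ → ℝ≥0∞}
    (hH : ∀ a q, Measurable (fun ω => H ω a q)) (l : List α)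
    {T : Ω → Finset (Site d × ℕ) → ℝ≥0∞} (hT : ∀ B, Measurable (fun ω => T ω B))
    (B : Finset (Site d × ℕ)) : Measurable (fun ω => tupleSum (H ω) l (T ω) B) := by
  induction l generalizing B with
  | nil => exact hT B
  | cons a l ih =>
    refine Measurable.tsum fun q => ?_
    by_cases hq : q ∈ B
    · simp [hq]
    · simp only [hq, if_false]
      exact (hH a q).mul (ih _)

/-- Marks of distinct particles are independent of one another and of `init`. The existence
indicators at one site are dependent, so they stay together under one integral. -/
lemma lintegral_prod_markWeight (h : IsMarkedField P ρ init X) (B : Finset (Site d × ℕ))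
    (z : Site d × ℕ → 𝒳 → ℝ≥0∞) :
    ∫⁻ ω, ∏ q ∈ B, markWeight init X ω (z q) q ∂P =
      (∏ q ∈ B, ∫⁻ ω, z q (X q ω) ∂P) *
        ∫⁻ ω, ∏ q ∈ B, (if q.2 < init ω q.1 then (1 : ℝ≥0∞) else 0) ∂P := by
  simp only [markWeight_eq_mul, Finset.prod_mul_distrib]
  have h1 := lintegral_prod_eq_prod_lintegral_of_indepFun (μ := P) B
    (fun q ω => z q (X q ω)) (h.indep.comp (fun q => z q) fun q => Measurable.of_discrete)
    (fun q => (Measurable.of_discrete (f := z q)).comp (h.measurable q))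
  rw [← h1]
  have hf : Measurable (fun n : Config d =>
      ∏ q ∈ B, (if q.2 < n q.1 then (1 : ℝ≥0∞) else 0)) :=
    Finset.measurable_prod _ fun q _ => measurable_alive measurable_id q
  have hg : Measurable (fun x : Site d × ℕ → 𝒳 => ∏ q ∈ B, z q (x q)) :=
    Finset.measurable_prod _ fun q _ =>
      (Measurable.of_discrete (f := z q)).comp (measurable_pi_apply q)
  have h2 := lintegral_mul_eq_lintegral_mul_lintegral_of_indepFun
    (hf.comp h.measurable_init) (hg.comp (measurable_pi_lambda _ h.measurable))
    (h.indep_init.comp hf hg)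
  exact h2.trans (mul_comm _ _)

/-- Averages out the marks. The product over `B`, with arbitrary weights `z`, records the particles
already chosen and is there for the induction; the application has `B = ∅`. -/
lemma lintegral_prod_mul_tupleSum (h : IsMarkedField P ρ init X) (l : List (𝒳 → ℝ≥0∞))
    (B : Finset (Site d × ℕ)) (z : Site d × ℕ → 𝒳 → ℝ≥0∞) :
    ∫⁻ ω, (∏ q ∈ B, markWeight init X ω (z q) q) * tupleSum (markWeight init X ω) l 1 B ∂P =
      (∏ q ∈ B, ∫⁻ ω, z q (X q ω) ∂P) *
        tupleSum (fun g q => ∫⁻ ω, g (X q ω) ∂P) l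
          (fun B' => ∫⁻ ω, ∏ q ∈ B', (if q.2 < init ω q.1 then (1 : ℝ≥0∞) else 0) ∂P) B := by
  induction l generalizing B z with
  | nil => simpa [tupleSum] using h.lintegral_prod_markWeight B z
  | cons g l ih =>
    simp only [tupleSum, ← ENNReal.tsum_mul_left]
    rw [lintegral_tsum]
    · refine tsum_congr fun q => ?_
      by_cases hq : q ∈ B
      · simp [hq]
      simp only [hq, if_false]
      -- The newly chosen particle joins the product, with `g` as its weight.
      have h1 := ih (insert q B) (Function.update z q g)
      have h2 : ∀ r ∈ B, Function.update z q g r = z r := fun r hr =>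
        Function.update_of_ne (ne_of_mem_of_not_mem hr hq) _ _
      rw [Finset.prod_insert hq, Finset.prod_congr rfl (fun r hr => by rw [h2 r hr])] at h1
      simp only [Finset.prod_insert hq, Function.update_self] at h1
      rw [show (∏ q ∈ B, ∫⁻ ω, z q (X q ω) ∂P) * ((∫⁻ ω, g (X q ω) ∂P) *
        tupleSum (fun g q => ∫⁻ ω, g (X q ω) ∂P) l
          (fun B' => ∫⁻ ω, ∏ q ∈ B', (if q.2 < init ω q.1 then (1 : ℝ≥0∞) else 0) ∂P)
          (insert q B)) = ((∫⁻ ω, g (X q ω) ∂P) * ∏ q ∈ B, ∫⁻ ω, z q (X q ω) ∂P) *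
        tupleSum (fun g q => ∫⁻ ω, g (X q ω) ∂P) l
          (fun B' => ∫⁻ ω, ∏ q ∈ B', (if q.2 < init ω q.1 then (1 : ℝ≥0∞) else 0) ∂P)
          (insert q B) by ring, ← h1]
      refine lintegral_congr fun ω => ?_
      have h3 : ∏ r ∈ B, markWeight init X ω (Function.update z q g r) r =
          ∏ r ∈ B, markWeight init X ω (z r) r :=
        Finset.prod_congr rfl fun r hr => by rw [h2 r hr]
      rw [h3]
      ring
    · intro q
      refine (Measurable.mul (Finset.measurable_prod _ fun r _ =>
        h.measurable_markWeight _ _) ?_).aemeasurable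
      by_cases hq : q ∈ B
      · simp [hq]
      · simp only [hq, if_false]
        exact (h.measurable_markWeight g q).mul
          (measurable_tupleSum h.measurable_markWeight l (T := fun _ => 1)
            (fun _ => measurable_const) _)

omit [MeasurableSpace 𝒳] [DiscreteMeasurableSpace 𝒳] in
-- Returns the existence indicators to the individual weights, so that the sum takes the form
-- required by `tupleSum_empty`.
lemma tupleSum_prod_alive (e : (𝒳 → ℝ≥0∞) → Site d → ℝ≥0∞) (n : Config d)
    (l : List (𝒳 → ℝ≥0∞)) (B : Finset (Site d × ℕ)) :
    tupleSum (fun g q => e g q.1) l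
      (fun B' => ∏ q ∈ B', (if q.2 < n q.1 then (1 : ℝ≥0∞) else 0)) B =
    (∏ q ∈ B, (if q.2 < n q.1 then (1 : ℝ≥0∞) else 0)) *
      tupleSum (fun g q => {q : Site d × ℕ | q.2 < n q.1}.indicator (fun q => e g q.1) q)
        l 1 B := by
  induction l generalizing B with
  | nil => simp [tupleSum]
  | cons g l ih =>
    simp only [tupleSum]
    rw [← ENNReal.tsum_mul_left]
    refine tsum_congr fun q => ?_
    by_cases hq : q ∈ B
    · simp [hq]
    · simp only [hq, if_false, ih, Finset.prod_insert hq]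
      by_cases h : q.2 < n q.1
      · simp only [h, if_true, Set.indicator, Set.mem_ofPred_eq]
        ring
      · simp [h]

omit [MeasurableSpace 𝒳] [DiscreteMeasurableSpace 𝒳] in
lemma lintegral_tupleSum_const {H : (𝒳 → ℝ≥0∞) → Site d × ℕ → ℝ≥0∞}
    {T : Ω → Finset (Site d × ℕ) → ℝ≥0∞} (hT : ∀ B, Measurable (fun ω => T ω B))
    (l : List (𝒳 → ℝ≥0∞)) (B : Finset (Site d × ℕ)) :
    ∫⁻ ω, tupleSum H l (T ω) B ∂P = tupleSum H l (fun B' => ∫⁻ ω, T ω B' ∂P) B := by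
  induction l generalizing B with
  | nil => rfl
  | cons g l ih =>
    simp only [tupleSum]
    have hm : ∀ B, Measurable (fun ω => tupleSum H l (T ω) B) :=
      measurable_tupleSum (H := fun _ => H) (fun _ _ => measurable_const) l hT
    rw [lintegral_tsum]
    · refine tsum_congr fun q => ?_
      by_cases hq : q ∈ B
      · simp [hq]
      · simp only [hq, if_false]
        rw [lintegral_const_mul _ (hm _), ih]
    · intro q
      by_cases hq : q ∈ B
      · simp [hq]
      · simpa [hq] using ((hm _).const_mul _).aemeasurable

omit [MeasurableSpace 𝒳] [DiscreteMeasurableSpace 𝒳] [MeasurableSpace Ω] in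
lemma fiber_eq_image (n : Config d) (u : Site d) :
    {q : Site d × ℕ | q ∈ {q : Site d × ℕ | q.2 < n q.1} ∧ q.1 = u} =
      (fun i => (u, i)) '' (Finset.range (n u) : Set ℕ) := by
  ext ⟨v, i⟩
  constructor
  · rintro ⟨h1, h2⟩
    simp only at h2
    subst h2
    exact ⟨i, by simpa using h1, rfl⟩
  · rintro ⟨j, hj, hji⟩
    simp only [Prod.mk.injEq] at hji
    obtain ⟨rfl, rfl⟩ := hji
    exact ⟨by simpa using hj, rfl⟩

/-- The multivariate Mecke formula. -/
lemma lintegral_tupleSum (h : IsMarkedField P ρ init X) (l : List (𝒳 → ℝ≥0∞)) :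
    ∫⁻ ω, tupleSum (markWeight init X ω) l 1 ∅ ∂P =
      (l.map (fun g => ρ * markIntensity P X g)).prod := by
  have h1 := h.lintegral_prod_mul_tupleSum l ∅ (fun _ => 0)
  simp only [Finset.prod_empty, one_mul] at h1
  simp only [h.law] at h1
  rw [h1, ← lintegral_tupleSum_const
    (T := fun ω B' => ∏ q ∈ B', (if q.2 < init ω q.1 then (1 : ℝ≥0∞) else 0))
    (fun B => Finset.measurable_prod _ fun q _ => measurable_alive h.measurable_init q)]
  -- After averaging, a weight depends on the starting site only, and exactly `init ω u` particles
  -- start at `u`.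
  have h2 : ∀ ω, tupleSum (fun (g : 𝒳 → ℝ≥0∞) (q : Site d × ℕ) => ∫⁻ ω, g (X (q.1, 0) ω) ∂P) l
      (fun B' => ∏ q ∈ B', (if q.2 < init ω q.1 then (1 : ℝ≥0∞) else 0)) ∅ =
      factSum (fun (g : 𝒳 → ℝ≥0∞) u => ∫⁻ ω, g (X (u, 0) ω) ∂P) (init ω) l 0 := by
    intro ω
    rw [tupleSum_prod_alive (fun (g : 𝒳 → ℝ≥0∞) u => ∫⁻ ω, g (X (u, 0) ω) ∂P) (init ω) l ∅,
      Finset.prod_empty, one_mul, tupleSum_empty (τ := Prod.fst)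
        (e := fun (g : 𝒳 → ℝ≥0∞) u => ∫⁻ ω, g (X (u, 0) ω) ∂P) (fun _ _ => rfl)
        (fun u => by rw [fiber_eq_image]; exact (Finset.finite_toSet _).image _)]
    congr 1
    funext u
    rw [fiber_eq_image, Set.ncard_image_of_injective _ (Prod.mk_right_injective u),
      Set.ncard_coe_finset, Finset.card_range]
  simp only [h2]
  rw [← lintegral_map (μ := P) (measurable_factSum _ l (by simp)) h.measurable_init, h.map_init,
    lintegral_factSum ρ _ l (by simp), lintegral_factProd ρ 0 ∅ (by simp)]
  simp [markIntensity]

/-- Joint factorial moments of two linear images of a marked Poisson field. -/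
lemma lintegral_tupleSum_mul_tupleSum (h : IsMarkedField P ρ init X) {β : Type*}
    (f f' : β → 𝒳 → ℝ≥0∞) (K : β → β → ℝ≥0∞) (hf : ∀ x, markIntensity P X (f x) = 1)
    (hf' : ∀ x, markIntensity P X (f' x) = 1)
    (hff' : ∀ x y, markIntensity P X (f x * f' y) = K x y) (xs ys : List β) :
    ∫⁻ ω, tupleSum (markWeight init X ω) (xs.map f) 1 ∅ *
      tupleSum (markWeight init X ω) (ys.map f') 1 ∅ ∂P = jointMoment (ρ : ℝ≥0∞) K xs ys := by
  have hT : ∀ l : List (𝒳 → ℝ≥0∞), ∀ B, Measurable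
      (fun ω => tupleSum (markWeight init X ω) l 1 B) := fun l B =>
    measurable_tupleSum h.measurable_markWeight l (T := fun _ => 1) (fun _ => measurable_const) B
  -- The prefix `zs` collects the entries already processed: each step of the product recursion
  -- moves an unmatched `x` or a merged pair `x * y` into it.
  have key : ∀ zs : List (𝒳 → ℝ≥0∞), ∫⁻ ω, tupleSum (markWeight init X ω) zs
      (tupleSum (markWeight init X ω) (xs.map f) 1 *
        tupleSum (markWeight init X ω) (ys.map f') 1) ∅ ∂P =
      (zs.map (fun g => ρ * markIntensity P X g)).prod * jointMoment (ρ : ℝ≥0∞) K xs ys := by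
    induction xs generalizing ys with
    | nil =>
      intro zs
      have h1 : ∀ ω, tupleSum (markWeight init X ω) ([] : List (𝒳 → ℝ≥0∞)) 1 *
          tupleSum (markWeight init X ω) (ys.map f') 1 =
          tupleSum (markWeight init X ω) (ys.map f') 1 := fun ω => by
        funext B; simp [tupleSum]
      simp only [List.map_nil, h1, ← tupleSum_append]
      rw [h.lintegral_tupleSum]
      simp [jointMoment, Function.comp_def, hf']
    | cons x xs ih =>
      intro zs
      have hm : ∀ (zs : List (𝒳 → ℝ≥0∞)) (ys : List β), Measurable fun ω =>
          tupleSum (markWeight init X ω) zs (tupleSum (markWeight init X ω) (xs.map f) 1 *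
            tupleSum (markWeight init X ω) (ys.map f') 1) ∅ := fun zs ys =>
        measurable_tupleSum h.measurable_markWeight zs
          (fun B => (hT (xs.map f) B).mul (hT (ys.map f') B)) ∅
      simp only [List.map_cons, tupleSum_mul_tupleSum (markWeight_mul _), tupleSum_add,
        tupleSum_pick, ← tupleSum_append, Pi.add_apply, pick_apply, pick_map]
      have hpick : ∀ (ys : List β) (F : β → List β → Ω → ℝ≥0∞),
          (∀ y l, Measurable (F y l)) → Measurable (fun ω => pick ys (fun y l => F y l ω)) ∧
          ∫⁻ ω, pick ys (fun y l => F y l ω) ∂P = pick ys (fun y l => ∫⁻ ω, F y l ω ∂P) := by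
        intro ys
        induction ys with
        | nil => intro F _; simp [pick]
        | cons y ys ihy =>
          intro F hF
          obtain ⟨h1, h2⟩ := ihy (fun a l => F a (y :: l)) (fun a l => hF a _)
          exact ⟨(hF y ys).add h1, by simp only [pick]; rw [lintegral_add_left (hF y ys), h2]⟩
      rw [lintegral_add_left (hm _ _), ih, (hpick ys _ fun y l => hm _ _).2]
      simp only [ih, List.map_append, List.map_cons, List.map_nil, List.prod_append,
        List.prod_singleton, hf, hff', jointMoment]
      rw [mul_add, mul_pick]
      congr 1
      · ring
      · exact pick_congr fun y l _ => by ring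
  have h0 := key []
  simpa [tupleSum] using h0

end IsMarkedField

/-! ### The heat kernel -/

section heatKernel

variable {d : ℕ} {p : Site d → Site d → ℝ}

/-- The pairing of a frequency with a lattice vector. -/
def freqDot (θ : Fin d → ℝ) (v : Site d) : ℝ := ∑ i, θ i * (v i : ℝ)

lemma freqDot_add (θ : Fin d → ℝ) (v w : Site d) :
    freqDot θ (v + w) = freqDot θ v + freqDot θ w := by
  simp [freqDot, mul_add, Finset.sum_add_distrib]

lemma freqDot_neg (θ : Fin d → ℝ) (v : Site d) : freqDot θ (-v) = -freqDot θ v := by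
  simp [freqDot]

lemma continuous_freqDot (v : Site d) : Continuous (fun θ => freqDot θ v) := by
  unfold freqDot
  fun_prop

/-- Lebesgue measure on `(-π, π]^d`. -/
noncomputable def torusMeasure (d : ℕ) : Measure (Fin d → ℝ) :=
  Measure.pi fun _ => volume.restrict (Set.Ioc (-Real.pi) Real.pi)

instance : IsFiniteMeasure (torusMeasure d) := by
  unfold torusMeasure
  infer_instance

lemma torusMeasure_real_univ : (torusMeasure d).real Set.univ = (2 * Real.pi) ^ d := by
  have h : Real.pi + Real.pi = 2 * Real.pi := by ring
  simp [torusMeasure, measureReal_def, Measure.pi_univ, h, Real.pi_pos.le]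

lemma integrable_torusMeasure {f : (Fin d → ℝ) → ℝ} (hf : Continuous f) {C : ℝ}
    (hC : ∀ θ, |f θ| ≤ C) : Integrable f (torusMeasure d) :=
  Integrable.of_bound hf.aestronglyMeasurable C (Eventually.of_forall hC)

lemma integral_cexp_freq (n : ℤ) :
    ∫ θ in Set.Ioc (-Real.pi) Real.pi, Complex.exp ((θ * n : ℝ) * Complex.I) =
      if n = 0 then (2 * Real.pi : ℂ) else 0 := by
  rw [← intervalIntegral.integral_of_le (by linarith [Real.pi_pos])]
  by_cases hn : n = 0
  · simp [hn]; ring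
  · have hc : (n : ℂ) * Complex.I ≠ 0 := by simp [hn]
    have h1 : ∀ θ : ℝ, Complex.exp ((θ * n : ℝ) * Complex.I) =
        Complex.exp (((n : ℂ) * Complex.I) * θ) := fun θ => by congr 1; push_cast; ring
    simp only [h1]
    rw [integral_exp_mul_complex hc, if_neg hn]
    have h2 : Complex.exp ((n : ℂ) * Complex.I * (Real.pi : ℝ)) =
        Complex.exp ((n : ℂ) * Complex.I * ((-Real.pi : ℝ) : ℂ)) := by
      rw [Complex.exp_eq_exp_iff_exists_int]
      exact ⟨n, by push_cast; ring⟩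
    rw [h2, sub_self, zero_div]

lemma integral_cos_freqDot (w : Site d) :
    ∫ θ, Real.cos (freqDot θ w) ∂(torusMeasure d) = if w = 0 then (2 * Real.pi) ^ d else 0 := by
  have h1 : ∀ θ : Fin d → ℝ, Complex.exp ((freqDot θ w : ℝ) * Complex.I) =
      ∏ i, Complex.exp ((θ i * w i : ℝ) * Complex.I) := by
    intro θ
    rw [← Complex.exp_sum, freqDot]
    push_cast
    rw [Finset.sum_mul]
  have h2 : ∫ θ, Complex.exp ((freqDot θ w : ℝ) * Complex.I) ∂(torusMeasure d) =
      ∏ i, if w i = 0 then (2 * Real.pi : ℂ) else 0 := by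
    simp only [h1]
    rw [torusMeasure, integral_fintype_prod_eq_prod
      (fun i (x : ℝ) => Complex.exp ((x * w i : ℝ) * Complex.I))]
    exact Finset.prod_congr rfl fun i _ => integral_cexp_freq (w i)
  have h3 : Integrable (fun θ => Complex.exp ((freqDot θ w : ℝ) * Complex.I)) (torusMeasure d) := by
    refine Integrable.of_bound (C := 1) ?_ (Eventually.of_forall fun θ => ?_)
    · have := continuous_freqDot w
      exact Continuous.aestronglyMeasurable (by fun_prop)
    · rw [Complex.norm_exp_ofReal_mul_I]
  have h4 := integral_re h3
  simp only [RCLike.re_eq_complex_re, Complex.exp_ofReal_mul_I_re] at h4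
  rw [h4, h2]
  by_cases hw : w = 0
  · have h5 : ((2 * Real.pi : ℂ)) = ((2 * Real.pi : ℝ) : ℂ) := by push_cast; rfl
    simp only [hw, Pi.zero_apply, if_true, Finset.prod_const, Finset.card_univ, Fintype.card_fin]
    rw [h5, ← Complex.ofReal_pow, Complex.ofReal_re]
  · obtain ⟨i, hi⟩ := Function.ne_iff.1 hw
    rw [if_neg hw, Finset.prod_eq_zero (Finset.mem_univ i) (by simpa using hi), Complex.zero_re]

/-- The characteristic function of a symmetric step distribution. -/
noncomputable def stepChar (p : Site d → Site d → ℝ) (θ : Fin d → ℝ) : ℝ :=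
  ∑' v, p 0 v * Real.cos (freqDot θ v)

namespace IsTransition

variable (hp : IsTransition p)
include hp

lemma neg_eq (v : Site d) : p 0 (-v) = p 0 v := by
  rw [hp.symm 0 v, hp.translation v 0, zero_sub]

lemma exists_finset_support : ∃ s : Finset (Site d), ∀ v ∉ s, p 0 v = 0 := by
  obtain ⟨R, _, hR⟩ := hp.finite_range
  have h : (Metric.closedBall (0 : Site d) R).Finite :=
    (isCompact_closedBall (0 : Site d) R).finite_of_discrete
  refine ⟨h.toFinset, fun v hv => hR 0 v ?_⟩
  simpa [dist_zero_right] using hv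

lemma summable_mul_bounded {f : Site d → ℝ} (hf : ∀ v, |f v| ≤ 1) :
    Summable fun v => p 0 v * f v := by
  refine Summable.of_norm_bounded (hp.sum_one 0).summable fun v => ?_
  rw [norm_mul, Real.norm_eq_abs, Real.norm_eq_abs, abs_of_nonneg (hp.nonneg 0 v)]
  exact mul_le_of_le_one_right (hp.nonneg 0 v) (hf v)

lemma continuous_stepChar : Continuous (stepChar p) := by
  obtain ⟨s, hs⟩ := hp.exists_finset_support
  have h : stepChar p = fun θ => ∑ v ∈ s, p 0 v * Real.cos (freqDot θ v) := by
    funext θ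
    exact tsum_eq_sum fun v hv => by simp [hs v hv]
  rw [h]
  have := continuous_freqDot (d := d)
  fun_prop

lemma abs_stepChar_le (θ : Fin d → ℝ) : |stepChar p θ| ≤ 1 := by
  have h := norm_tsum_le_tsum_norm (f := fun v => p 0 v * Real.cos (freqDot θ v))
    (hp.summable_mul_bounded fun v => Real.abs_cos_le_one _).norm
  refine h.trans ?_
  rw [← (hp.sum_one 0).tsum_eq]
  refine Summable.tsum_le_tsum (fun v => ?_)
    (hp.summable_mul_bounded fun v => Real.abs_cos_le_one _).norm (hp.sum_one 0).summable
  rw [norm_mul, Real.norm_eq_abs, Real.norm_eq_abs, abs_of_nonneg (hp.nonneg 0 v)]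
  exact mul_le_of_le_one_right (hp.nonneg 0 v) (Real.abs_cos_le_one _)

lemma one_sub_stepChar (θ : Fin d → ℝ) :
    HasSum (fun v => p 0 v * (2 * Real.sin (freqDot θ v / 2) ^ 2)) (1 - stepChar p θ) := by
  have h := (hp.sum_one 0).sub
    (hp.summable_mul_bounded (f := fun v => Real.cos (freqDot θ v))
      fun v => Real.abs_cos_le_one _).hasSum
  refine h.congr_fun fun v => ?_
  have := Real.cos_sq' (freqDot θ v / 2)
  have h2 := Real.cos_two_mul (freqDot θ v / 2)
  rw [mul_div_cancel₀ _ (two_ne_zero' ℝ)] at h2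
  rw [h2, this]
  ring

/-- Cosine waves are eigenfunctions of `p` with eigenvalue `stepChar p θ`; the sine part drops out
by symmetry. -/
lemma convolution_cos (θ : Fin d → ℝ) (x y : Site d) :
    ∑' z, p x z * Real.cos (freqDot θ (y - z)) =
      stepChar p θ * Real.cos (freqDot θ (y - x)) := by
  have hsin : ∑' v, p 0 v * Real.sin (freqDot θ v) = 0 := by
    have h := (Equiv.neg (Site d)).tsum_eq fun v => p 0 v * Real.sin (freqDot θ v)
    simp only [Equiv.neg_apply, hp.neg_eq, freqDot_neg, Real.sin_neg, mul_neg, tsum_neg] at h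
    linarith
  rw [← (Equiv.addLeft x).tsum_eq]
  have h1 : ∀ v, p x ((Equiv.addLeft x) v) * Real.cos (freqDot θ (y - (Equiv.addLeft x) v)) =
      p 0 v * Real.cos (freqDot θ v) * Real.cos (freqDot θ (y - x)) +
        p 0 v * Real.sin (freqDot θ v) * Real.sin (freqDot θ (y - x)) := by
    intro v
    rw [Equiv.coe_addLeft, hp.translation x (x + v), add_sub_cancel_left,
      show y - (x + v) = (y - x) + -v by abel, freqDot_add, freqDot_neg, ← sub_eq_add_neg,
      Real.cos_sub]
    ring
  simp only [h1]
  rw [Summable.tsum_add, tsum_mul_right, tsum_mul_right, hsin, zero_mul, add_zero, stepChar]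
  · exact (hp.summable_mul_bounded fun v => Real.abs_cos_le_one _).mul_right _
  · exact (hp.summable_mul_bounded fun v => Real.abs_sin_le_one _).mul_right _

lemma abs_pow_mul_cos_le (n : ℕ) (θ : Fin d → ℝ) (a : ℝ) :
    |stepChar p θ ^ n * Real.cos a| ≤ 1 := by
  rw [abs_mul, abs_pow]
  exact mul_le_one₀ (pow_le_one₀ (abs_nonneg _) (hp.abs_stepChar_le θ)) (abs_nonneg _)
    (Real.abs_cos_le_one _)

lemma integrable_pow_mul_cos (n : ℕ) (w : Site d) :
    Integrable (fun θ => stepChar p θ ^ n * Real.cos (freqDot θ w)) (torusMeasure d) := by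
  have h1 := hp.continuous_stepChar
  have h2 := continuous_freqDot w
  exact integrable_torusMeasure (by fun_prop) fun θ => hp.abs_pow_mul_cos_le n θ _

/-- Fourier inversion by induction: orthogonality of characters for `n = 0`, then one eigenvalue per
step. Finite range makes each convolution a finite sum. -/
lemma stepProb_eq_integral (n : ℕ) (x y : Site d) :
    (2 * Real.pi) ^ d * stepProb p n x y =
      ∫ θ, stepChar p θ ^ n * Real.cos (freqDot θ (y - x)) ∂(torusMeasure d) := by
  induction n generalizing x with
  | zero =>
    simp only [stepProb, pow_zero, one_mul]
    rw [integral_cos_freqDot]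
    by_cases h : x = y
    · simp [h]
    · simp [h, sub_eq_zero, Ne.symm h]
  | succ n ih =>
    obtain ⟨s, hs⟩ := hp.exists_finset_support
    have hs' : ∀ z ∉ s.map (Equiv.addLeft x).toEmbedding, p x z = 0 := by
      intro z hz
      rw [hp.translation]
      refine hs _ fun h => hz ?_
      simp only [Finset.mem_map_equiv]
      simpa [sub_eq_neg_add] using h
    set S := s.map (Equiv.addLeft x).toEmbedding
    have h1 : ∀ θ, stepChar p θ ^ (n + 1) * Real.cos (freqDot θ (y - x)) =
        ∑ z ∈ S, p x z * (stepChar p θ ^ n * Real.cos (freqDot θ (y - z))) := by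
      intro θ
      rw [pow_succ, mul_assoc, ← hp.convolution_cos, tsum_eq_sum (s := S)
        (fun z hz => by simp [hs' z hz]), Finset.mul_sum]
      exact Finset.sum_congr rfl fun z _ => by ring
    simp only [h1, stepProb]
    rw [integral_finsetSum _ fun z _ => (hp.integrable_pow_mul_cos n _).const_mul _,
      tsum_eq_sum (s := S) (fun z hz => by simp [hs' z hz]), Finset.mul_sum]
    refine Finset.sum_congr rfl fun z _ => ?_
    rw [integral_const_mul, ← ih]
    ring

lemma stepProb_nonneg (n : ℕ) (x y : Site d) : 0 ≤ stepProb p n x y := by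
  induction n generalizing x with
  | zero => simp only [stepProb]; split_ifs <;> simp
  | succ n ih => exact tsum_nonneg fun z => mul_nonneg (hp.nonneg _ _) (ih z)

lemma walkProb_nonneg {t : ℝ} (ht : 0 ≤ t) (x y : Site d) : 0 ≤ walkProb p t x y :=
  tsum_nonneg fun n => mul_nonneg (by positivity) (hp.stepProb_nonneg n x y)

/-- Averaging `stepChar p θ ^ n` over a Poisson number of jumps gives the exponential. -/
lemma walkProb_eq_integral {t : ℝ} (ht : 0 ≤ t) (x y : Site d) :
    (2 * Real.pi) ^ d * walkProb p t x y =
      ∫ θ, Real.exp (-t * (1 - stepChar p θ)) * Real.cos (freqDot θ (y - x))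
        ∂(torusMeasure d) := by
  have hE : ∀ a : ℝ, HasSum (fun n : ℕ => a ^ n / n.factorial) (Real.exp a) := fun a => by
    rw [Real.exp_eq_exp_ℝ]
    exact NormedSpace.expSeries_div_hasSum_exp a
  have h1 : ∀ θ, ∑' n : ℕ, Real.exp (-t) * t ^ n / (n.factorial : ℝ) *
      (stepChar p θ ^ n * Real.cos (freqDot θ (y - x))) =
      Real.exp (-t * (1 - stepChar p θ)) * Real.cos (freqDot θ (y - x)) := by
    intro θ
    have h := ((hE (t * stepChar p θ)).mul_left (Real.exp (-t))).mul_right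
      (Real.cos (freqDot θ (y - x)))
    rw [← Real.exp_add, show -t + t * stepChar p θ = -t * (1 - stepChar p θ) by ring] at h
    rw [← h.tsum_eq]
    refine tsum_congr fun n => ?_
    rw [mul_pow]
    ring
  simp only [← h1]
  rw [← integral_tsum_of_summable_integral_norm]
  · rw [walkProb, ← tsum_mul_left]
    refine tsum_congr fun n => ?_
    rw [integral_const_mul, ← hp.stepProb_eq_integral]
    ring
  · exact fun n => (hp.integrable_pow_mul_cos n _).const_mul _
  · refine Summable.of_nonneg_of_le (fun n => integral_nonneg fun θ => norm_nonneg _)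
      (fun n => ?_) (((hE t).summable.mul_left (Real.exp (-t))).mul_right
        ((torusMeasure d).real Set.univ))
    have h2 : ∀ θ, ‖Real.exp (-t) * t ^ n / (n.factorial : ℝ) *
        (stepChar p θ ^ n * Real.cos (freqDot θ (y - x)))‖ ≤
        Real.exp (-t) * (t ^ n / (n.factorial : ℝ)) := by
      intro θ
      rw [norm_mul, Real.norm_of_nonneg (by positivity), ← mul_div_assoc]
      exact mul_le_of_le_one_right (by positivity) (hp.abs_pow_mul_cos_le n θ _)
    calc _ ≤ ∫ _, Real.exp (-t) * (t ^ n / (n.factorial : ℝ)) ∂(torusMeasure d) :=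
          integral_mono ((hp.integrable_pow_mul_cos n _).const_mul _).norm
            (integrable_const _) h2
      _ = _ := by rw [integral_const, smul_eq_mul, mul_comm]

lemma walkProb_symm {t : ℝ} (ht : 0 ≤ t) (x y : Site d) :
    walkProb p t x y = walkProb p t y x := by
  have h : (2 * Real.pi) ^ d * walkProb p t x y = (2 * Real.pi) ^ d * walkProb p t y x := by
    rw [hp.walkProb_eq_integral ht, hp.walkProb_eq_integral ht]
    refine integral_congr_ae (Eventually.of_forall fun θ => ?_)
    simp only
    rw [← neg_sub x y, freqDot_neg, Real.cos_neg]
  exact mul_left_cancel₀ (by positivity) h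

lemma continuous_exp_mul_cos (t : ℝ) (w : Site d) :
    Continuous fun θ => Real.exp (-t * (1 - stepChar p θ)) * Real.cos (freqDot θ w) := by
  have h1 := hp.continuous_stepChar
  have h2 := continuous_freqDot w
  fun_prop

omit hp in
lemma abs_exp_mul_cos_le (t : ℝ) (θ : Fin d → ℝ) (a : ℝ) :
    |Real.exp (-t * (1 - stepChar p θ)) * Real.cos a| ≤ Real.exp (-t * (1 - stepChar p θ)) := by
  rw [abs_mul, Real.abs_exp]
  exact mul_le_of_le_one_right (Real.exp_pos _).le (Real.abs_cos_le_one _)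

lemma exp_le_one {t : ℝ} (ht : 0 ≤ t) (θ : Fin d → ℝ) :
    Real.exp (-t * (1 - stepChar p θ)) ≤ 1 := by
  rw [Real.exp_le_one_iff]
  have := (abs_le.1 (hp.abs_stepChar_le θ)).2
  nlinarith

lemma walkProb_le_one {t : ℝ} (ht : 0 ≤ t) (x y : Site d) : walkProb p t x y ≤ 1 := by
  have h : (2 * Real.pi) ^ d * walkProb p t x y ≤ (2 * Real.pi) ^ d * 1 := by
    rw [hp.walkProb_eq_integral ht, ← torusMeasure_real_univ, mul_one]
    have hb : ∀ θ, |Real.exp (-t * (1 - stepChar p θ)) * Real.cos (freqDot θ (y - x))| ≤ 1 :=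
      fun θ => (abs_exp_mul_cos_le t θ _).trans (hp.exp_le_one ht θ)
    calc _ ≤ ∫ _, (1 : ℝ) ∂(torusMeasure d) :=
          integral_mono (integrable_torusMeasure (hp.continuous_exp_mul_cos t _) hb)
            (integrable_const _) fun θ => (le_abs_self _).trans (hb θ)
      _ = _ := by simp
  exact le_of_mul_le_mul_left h (by positivity)

/-- Irreducibility enters here. For a step `v` with `p 0 v > 0`, the single term of `v` in `1 -
stepChar p θ` controls `sin²(θ·v/2)`; along a path to `x` these add up because `|sin (a + b)| ≤ |sin
a| + |sin b|`. -/
lemma exists_sin_sq_le (x : Site d) :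
    ∃ C : ℝ, 0 ≤ C ∧ ∀ θ, Real.sin (freqDot θ x / 2) ^ 2 ≤ C * (1 - stepChar p θ) := by
  induction hp.irreducible 0 x with
  | refl => exact ⟨0, le_rfl, fun θ => by simp [freqDot]⟩
  | @tail y z _ hyz ih =>
    obtain ⟨C, hC, h⟩ := ih
    rw [hp.translation] at hyz
    have hstep : ∀ θ, Real.sin (freqDot θ (z - y) / 2) ^ 2 ≤
        (p 0 (z - y))⁻¹ * (1 - stepChar p θ) := by
      intro θ
      have h1 := (hp.one_sub_stepChar θ).summable.le_tsum (z - y)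
        fun v _ => mul_nonneg (hp.nonneg 0 v) (by positivity)
      rw [(hp.one_sub_stepChar θ).tsum_eq] at h1
      rw [inv_mul_eq_div, le_div_iff₀ hyz]
      nlinarith [mul_nonneg hyz.le (sq_nonneg (Real.sin (freqDot θ (z - y) / 2)))]
    refine ⟨2 * (C + (p 0 (z - y))⁻¹), by positivity, fun θ => ?_⟩
    have h2 : freqDot θ z / 2 = freqDot θ y / 2 + freqDot θ (z - y) / 2 := by
      rw [← add_div, ← freqDot_add, add_sub_cancel]
    set a := freqDot θ y / 2
    set b := freqDot θ (z - y) / 2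
    have h3 : Real.sin (a + b) ^ 2 ≤ 2 * (Real.sin a ^ 2 + Real.sin b ^ 2) := by
      have h4 : |Real.sin (a + b)| ≤ |Real.sin a| + |Real.sin b| := by
        rw [Real.sin_add]
        refine (abs_add_le _ _).trans (add_le_add ?_ ?_)
        · rw [abs_mul]
          exact mul_le_of_le_one_right (abs_nonneg _) (Real.abs_cos_le_one _)
        · rw [abs_mul]
          exact mul_le_of_le_one_left (abs_nonneg _) (Real.abs_cos_le_one _)
      rw [← sq_abs (Real.sin (a + b)), ← sq_abs (Real.sin a), ← sq_abs (Real.sin b)]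
      nlinarith [abs_nonneg (Real.sin (a + b)), sq_nonneg (|Real.sin a| - |Real.sin b|)]
    rw [h2]
    nlinarith [h θ, hstep θ]

/-- The previous bound at the unit vectors, combined with Jordan's inequality `|θ_i| ≤ π
|sin(θ_i/2)|` on the cube. -/
lemma exists_quadratic_le :
    ∃ c : ℝ, 0 < c ∧ ∀ θ : Fin d → ℝ, (∀ i, |θ i| ≤ Real.pi) →
      c * ∑ i, θ i ^ 2 ≤ 1 - stepChar p θ := by
  choose C hC h using fun i : Fin d => hp.exists_sin_sq_le (Pi.single i 1)
  -- The `+ 1` keeps the constant invertible even if every `C i` is zero.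
  have hpos : 0 < Real.pi ^ 2 * ∑ i, C i + 1 := by
    have := Finset.sum_nonneg fun i (_ : i ∈ Finset.univ) => hC i
    positivity
  refine ⟨(Real.pi ^ 2 * ∑ i, C i + 1)⁻¹, by positivity, fun θ hθ => ?_⟩
  rw [inv_mul_le_iff₀ hpos]
  have h0 : 0 ≤ 1 - stepChar p θ := by linarith [(abs_le.1 (hp.abs_stepChar_le θ)).2]
  have h1 : ∀ i, θ i ^ 2 ≤ Real.pi ^ 2 * (C i * (1 - stepChar p θ)) := by
    intro i
    have h2 : freqDot θ (Pi.single i 1) = θ i := by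
      rw [freqDot, Finset.sum_eq_single i (fun j _ hj => by simp [hj]) (by simp)]
      simp
    have h3 := h i θ
    rw [h2] at h3
    have h4 := Real.mul_abs_le_abs_sin (x := θ i / 2) (by
      rw [abs_div, abs_two]; linarith [hθ i])
    have h5 : |θ i| ≤ Real.pi * |Real.sin (θ i / 2)| := by
      rw [abs_div, abs_two] at h4
      have h6 : 2 / Real.pi * (|θ i| / 2) = |θ i| / Real.pi := by ring
      rw [h6, div_le_iff₀ Real.pi_pos] at h4
      linarith
    calc θ i ^ 2 = |θ i| ^ 2 := (sq_abs _).symm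
      _ ≤ (Real.pi * |Real.sin (θ i / 2)|) ^ 2 := by gcongr
      _ = Real.pi ^ 2 * Real.sin (θ i / 2) ^ 2 := by rw [mul_pow, sq_abs]
      _ ≤ _ := by gcongr
  calc ∑ i, θ i ^ 2 ≤ ∑ i, Real.pi ^ 2 * (C i * (1 - stepChar p θ)) :=
        Finset.sum_le_sum fun i _ => h1 i
    _ = (Real.pi ^ 2 * ∑ i, C i) * (1 - stepChar p θ) := by
        rw [← Finset.mul_sum, ← Finset.sum_mul, mul_assoc]
    _ ≤ _ := by nlinarith

/-- The on-diagonal heat kernel bound. -/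
lemma exists_walkProb_le :
    ∃ A : ℝ, 0 ≤ A ∧ ∀ t : ℝ, 0 < t → ∀ x y, walkProb p t x y ≤ A * t ^ (-((d : ℝ) / 2)) := by
  obtain ⟨c, hc, hq⟩ := hp.exists_quadratic_le
  refine ⟨((2 * Real.pi) ^ d)⁻¹ * √(Real.pi / c) ^ d, by positivity, fun t ht x y => ?_⟩
  have hg : Integrable (fun x : ℝ => Real.exp (-(t * c) * x ^ 2)) :=
    integrable_exp_neg_mul_sq (by positivity)
  have hae : ∀ᵐ θ ∂(torusMeasure d), ∀ i, |θ i| ≤ Real.pi := by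
    rw [ae_all_iff]
    intro i
    have h1 : ∀ᵐ x ∂(volume.restrict (Set.Ioc (-Real.pi) Real.pi)), |x| ≤ Real.pi := by
      filter_upwards [ae_restrict_mem measurableSet_Ioc] with x hx
      exact abs_le.2 ⟨hx.1.le, hx.2⟩
    exact (Measure.tendsto_eval_ae_ae
      (μ := fun _ : Fin d => volume.restrict (Set.Ioc (-Real.pi) Real.pi)) (i := i)).eventually h1
  have h1 : (2 * Real.pi) ^ d * walkProb p t x y ≤ √(Real.pi / (t * c)) ^ d := by
    rw [hp.walkProb_eq_integral ht.le]
    -- The integrand is dominated on the cube by a product Gaussian, whose factors are then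
    -- integrated over all of `ℝ`.
    calc _ ≤ ∫ θ, ∏ i, Real.exp (-(t * c) * θ i ^ 2) ∂(torusMeasure d) := by
          refine integral_mono_ae (integrable_torusMeasure (hp.continuous_exp_mul_cos t _)
            fun θ => (abs_exp_mul_cos_le t θ _).trans (hp.exp_le_one ht.le θ)) ?_ ?_
          · exact Integrable.fintype_prod (f := fun _ (x : ℝ) => Real.exp (-(t * c) * x ^ 2))
              fun _ => hg.restrict
          · filter_upwards [hae] with θ hθ
            refine (le_abs_self _).trans ((abs_exp_mul_cos_le t θ _).trans ?_)
            rw [← Real.exp_sum, Real.exp_le_exp, ← Finset.mul_sum]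
            have := mul_le_mul_of_nonneg_left (hq θ hθ) ht.le
            linarith
      _ = (∫ x in Set.Ioc (-Real.pi) Real.pi, Real.exp (-(t * c) * x ^ 2)) ^ d := by
          rw [torusMeasure, integral_fintype_prod_eq_pow
            (fun x : ℝ => Real.exp (-(t * c) * x ^ 2)), Fintype.card_fin]
      _ ≤ (∫ x, Real.exp (-(t * c) * x ^ 2)) ^ d := by
          refine pow_le_pow_left₀ (integral_nonneg fun x => (Real.exp_pos _).le) ?_ d
          exact setIntegral_le_integral hg (Eventually.of_forall fun x => (Real.exp_pos _).le)
      _ = _ := by rw [integral_gaussian]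
  have h2 : √(Real.pi / (t * c)) ^ d = √(Real.pi / c) ^ d * t ^ (-((d : ℝ) / 2)) := by
    rw [show Real.pi / (t * c) = (Real.pi / c) * t⁻¹ by field_simp, Real.sqrt_mul (by positivity),
      mul_pow]
    congr 1
    rw [Real.sqrt_eq_rpow, ← Real.rpow_natCast, ← Real.rpow_mul (by positivity),
      Real.inv_rpow ht.le, ← Real.rpow_neg ht.le]
    congr 1
    ring
  rw [h2] at h1
  rw [mul_assoc, ← div_eq_inv_mul, le_div_iff₀ (by positivity), mul_comm]
  exact h1

end IsTransition

end heatKernel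

/-! ### Two-time laws of walks -/

section walk

variable {d : ℕ} {Ω : Type*} [MeasurableSpace Ω] {P : Measure Ω} [IsProbabilityMeasure P]
  {p : Site d → Site d → ℝ} {x : Site d} {Y : ℝ → Ω → Site d}

namespace IsWalk

lemma ae_eq_start (h : IsWalk P p x Y) : ∀ᵐ ω ∂P, Y 0 ω = x := by
  have h1 := h.fdd 0 (fun _ => 0) (fun _ => x) monotone_const rfl rfl
  simp only [nonpos_iff_eq_zero, forall_eq, Finset.range_zero, Finset.prod_empty,
    ENNReal.ofReal_one] at h1
  have h2 : MeasurableSet {ω | Y 0 ω = x} :=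
    (h.measurable 0 le_rfl) (MeasurableSet.singleton x)
  rw [← prob_compl_eq_zero_iff h2] at h1
  exact h1

lemma measure_pair_eq (h : IsWalk P p x Y) {s t : ℝ} (hs : 0 ≤ s) (hst : s ≤ t) (a b : Site d) :
    P {ω | Y s ω = a ∧ Y t ω = b} =
      ENNReal.ofReal (walkProb p s x a * walkProb p (t - s) a b) := by
  -- Times `0, s, t`, constant afterwards. The condition at time `0` holds almost surely and can be
  -- dropped.
  have h1 := h.fdd 2 (fun i => if i = 0 then 0 else if i = 1 then s else t)
    (fun i => if i = 0 then x else if i = 1 then a else b) (by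
      refine monotone_nat_of_le_succ fun n => ?_
      rcases n with _ | _ | n <;> simp [hs, hst]) rfl rfl
  simp only [Finset.prod_range_succ, Finset.prod_range_zero, one_mul] at h1
  norm_num at h1
  rw [← h1]
  refine measure_congr ?_
  filter_upwards [h.ae_eq_start] with ω hω
  apply propext
  constructor
  · rintro ⟨h2, h3⟩ i hi
    interval_cases i <;> simp_all
  · intro h2
    exact ⟨by simpa using h2 1 (by norm_num), by simpa using h2 2 (by norm_num)⟩

lemma measure_eq (h : IsWalk P p x Y) {t : ℝ} (ht : 0 ≤ t) (a : Site d) :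
    P {ω | Y t ω = a} = ENNReal.ofReal (walkProb p t x a) := by
  have h1 := h.fdd 1 (fun i => if i = 0 then 0 else t)
    (fun i => if i = 0 then x else a) (by
      refine monotone_nat_of_le_succ fun n => ?_
      rcases n with _ | n <;> simp [ht]) rfl rfl
  simp only [Finset.prod_range_succ, Finset.prod_range_zero, one_mul] at h1
  norm_num at h1
  rw [← h1]
  refine measure_congr ?_
  filter_upwards [h.ae_eq_start] with ω hω
  apply propext
  constructor
  · intro h2 i hi
    have h2' : Y t ω = a := h2
    interval_cases i <;> simp_all
  · intro h2
    have h3 := h2 1 le_rfl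
    exact (by simpa using h3 : Y t ω = a)

/-- The total mass is read off from the walk itself: `Y t` takes some value in a countable set. -/
lemma tsum_walkProb (h : IsWalk P p x Y) {t : ℝ} (ht : 0 ≤ t) :
    ∑' y, ENNReal.ofReal (walkProb p t x y) = 1 := by
  simp only [← h.measure_eq ht]
  have h1 := tsum_measure_preimage_singleton (μ := P) (s := Set.univ) (f := Y t)
    Set.countable_univ (fun y _ => (h.measurable t ht) (MeasurableSet.singleton y))
  rw [Set.preimage_univ, measure_univ, tsum_univ (fun y => P (Y t ⁻¹' {y}))] at h1
  exact h1

end IsWalk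

end walk

/-! ### Factorial moments of the system of independent walkers -/

/-- The indicator that the first mark is `x`. -/
noncomputable def fstMark {σ : Type*} [DecidableEq σ] (x : σ) (z : σ × σ) : ℝ≥0∞ :=
  if z.1 = x then 1 else 0

/-- The indicator that the second mark is `x`. -/
noncomputable def sndMark {σ : Type*} [DecidableEq σ] (x : σ) (z : σ × σ) : ℝ≥0∞ :=
  if z.2 = x then 1 else 0

section walkers

variable {d : ℕ} {Ω : Type*} [MeasurableSpace Ω] {P : Measure Ω} [IsProbabilityMeasure P]
  {p : Site d → Site d → ℝ} {ρ : ℝ≥0} {init : Ω → Config d} {Y : Site d × ℕ → ℝ → Ω → Site d}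

/-- The mark of a particle is its pair of positions at the two times; the two-time probabilities
determine its law and involve only the starting site. -/
lemma isMarkedField_walks (hinit : Measurable init) (hmap : P.map init = poissonField d ρ)
    (hY : ∀ q, IsWalk P p q.1 (Y q))
    (hind : iIndepFun (fun (q : Site d × ℕ) (ω : Ω) (t : ℝ≥0) => Y q t ω) P)
    (hind' : IndepFun init (fun (ω : Ω) (q : Site d × ℕ) (t : ℝ≥0) => Y q t ω) P)
    {t s : ℝ} (ht : 0 ≤ t) (hs : 0 ≤ s) :
    IsMarkedField P ρ init (fun q ω => (Y q t ω, Y q s ω)) := by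
  have hm : Measurable (fun y : ℝ≥0 → Site d => (y ⟨t, ht⟩, y ⟨s, hs⟩)) := by fun_prop
  have hmX : ∀ q, Measurable (fun ω => (Y q t ω, Y q s ω)) := fun q =>
    ((hY q).measurable t ht).prodMk ((hY q).measurable s hs)
  refine ⟨hinit, hmap, hmX, hind.comp (fun _ y => (y ⟨t, ht⟩, y ⟨s, hs⟩)) fun _ => hm, ?_, ?_⟩
  · exact hind'.comp measurable_id
      (ψ := fun (y : Site d × ℕ → ℝ≥0 → Site d) q => (y q ⟨t, ht⟩, y q ⟨s, hs⟩)) (by fun_prop)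
  · intro q g
    have hlaw : P.map (fun ω => (Y q t ω, Y q s ω)) =
        P.map (fun ω => (Y (q.1, 0) t ω, Y (q.1, 0) s ω)) := by
      refine Measure.ext_of_singleton fun ⟨a, b⟩ => ?_
      rw [Measure.map_apply (hmX _) (MeasurableSet.singleton _),
        Measure.map_apply (hmX _) (MeasurableSet.singleton _)]
      have hset : ∀ q, (fun ω => (Y q t ω, Y q s ω)) ⁻¹' {(a, b)} =
          {ω | Y q t ω = a ∧ Y q s ω = b} := fun q => by ext; simp
      rw [hset, hset]
      rcases le_total t s with hts | hst
      · rw [(hY q).measure_pair_eq ht hts, (hY (q.1, 0)).measure_pair_eq ht hts]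
      · have hcomm : ∀ q, {ω | Y q t ω = a ∧ Y q s ω = b} = {ω | Y q s ω = b ∧ Y q t ω = a} :=
          fun q => by ext; exact and_comm
        rw [hcomm, hcomm, (hY q).measure_pair_eq hs hst, (hY (q.1, 0)).measure_pair_eq hs hst]
    rw [← lintegral_map Measurable.of_discrete (hmX q), hlaw,
      lintegral_map Measurable.of_discrete (hmX _)]

/-- Stationarity of counting measure: symmetry turns the sum over starting points into a sum over
end points. -/
lemma tsum_measure_walk (hp : IsTransition p) (hY : ∀ q : Site d × ℕ, IsWalk P p q.1 (Y q))
    {t : ℝ} (ht : 0 ≤ t) (x : Site d) : ∑' u : Site d, P {ω | Y (u, 0) t ω = x} = 1 := by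
  simp only [fun u => (hY (u, 0)).measure_eq ht x, fun u => hp.walkProb_symm ht u x]
  exact (hY (x, 0)).tsum_walkProb ht

lemma markIntensity_fstMark (hp : IsTransition p) (hY : ∀ q : Site d × ℕ, IsWalk P p q.1 (Y q))
    {t s : ℝ} (ht : 0 ≤ t) (x : Site d) :
    markIntensity P (fun q ω => (Y q t ω, Y q s ω)) (fstMark x) = 1 := by
  rw [← tsum_measure_walk hp hY ht x, markIntensity]
  refine tsum_congr fun u => ?_
  have hm : MeasurableSet {ω | Y (u, 0) t ω = x} :=
    ((hY (u, 0)).measurable t ht) (MeasurableSet.singleton x)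
  rw [← lintegral_indicator_one hm]
  refine lintegral_congr fun ω => ?_
  by_cases h : Y (u, 0) t ω = x <;> simp [fstMark, h]

lemma markIntensity_sndMark (hp : IsTransition p) (hY : ∀ q : Site d × ℕ, IsWalk P p q.1 (Y q))
    {t s : ℝ} (hs : 0 ≤ s) (x : Site d) :
    markIntensity P (fun q ω => (Y q t ω, Y q s ω)) (sndMark x) = 1 := by
  rw [← tsum_measure_walk hp hY hs x, markIntensity]
  refine tsum_congr fun u => ?_
  have hm : MeasurableSet {ω | Y (u, 0) s ω = x} :=
    ((hY (u, 0)).measurable s hs) (MeasurableSet.singleton x)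
  rw [← lintegral_indicator_one hm]
  refine lintegral_congr fun ω => ?_
  by_cases h : Y (u, 0) s ω = x <;> simp [sndMark, h]

lemma tsum_measure_pair (hp : IsTransition p) (hY : ∀ q : Site d × ℕ, IsWalk P p q.1 (Y q))
    {s t : ℝ} (hs : 0 ≤ s) (hst : s ≤ t) (a b : Site d) :
    ∑' u : Site d, P {ω | Y (u, 0) s ω = a ∧ Y (u, 0) t ω = b} =
      ENNReal.ofReal (walkProb p (t - s) a b) := by
  simp only [fun u => (hY (u, 0)).measure_pair_eq hs hst a b, fun u => hp.walkProb_symm hs u a,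
    fun u => ENNReal.ofReal_mul (q := walkProb p (t - s) a b) (hp.walkProb_nonneg hs a u)]
  rw [ENNReal.tsum_mul_right, (hY (a, 0)).tsum_walkProb hs, one_mul]

lemma markIntensity_fstMark_mul_sndMark (hp : IsTransition p)
    (hY : ∀ q : Site d × ℕ, IsWalk P p q.1 (Y q)) {t s : ℝ} (ht : 0 ≤ t) (hs : 0 ≤ s)
    (x y : Site d) :
    markIntensity P (fun q ω => (Y q t ω, Y q s ω)) (fstMark x * sndMark y) =
      ENNReal.ofReal (walkProb p |t - s| x y) := by
  have h1 : markIntensity P (fun q ω => (Y q t ω, Y q s ω)) (fstMark x * sndMark y) =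
      ∑' u : Site d, P {ω | Y (u, 0) t ω = x ∧ Y (u, 0) s ω = y} := by
    refine tsum_congr fun u => ?_
    have hm : MeasurableSet {ω | Y (u, 0) t ω = x ∧ Y (u, 0) s ω = y} :=
      (((hY (u, 0)).measurable t ht) (MeasurableSet.singleton x)).inter
        (((hY (u, 0)).measurable s hs) (MeasurableSet.singleton y))
    rw [← lintegral_indicator_one hm]
    refine lintegral_congr fun ω => ?_
    by_cases h1 : Y (u, 0) t ω = x <;> by_cases h2 : Y (u, 0) s ω = y <;>
      simp [fstMark, sndMark, h1, h2]
  rw [h1]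
  rcases le_total t s with hts | hst
  · rw [tsum_measure_pair hp hY ht hts, abs_of_nonpos (by linarith), neg_sub]
  · simp only [and_comm (a := Y _ t _ = x)]
    rw [tsum_measure_pair hp hY hs hst, abs_of_nonneg (by linarith),
      hp.walkProb_symm (by linarith)]

/-- The product of falling factorials of a configuration along a list of sites. -/
noncomputable def factMoment (l : List (Site d)) (η : Config d) : ℝ :=
  factProd η (fun u => l.count u)

omit [MeasurableSpace Ω] in
/-- If all sites carry finitely many particles, the falling factorials of the configuration are
tuple sums. -/
lemma factMoment_configAt {t : ℝ} {ω : Ω} {H : Site d → Site d × ℕ → ℝ≥0∞}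
    (hH : ∀ x q, H x q = {q : Site d × ℕ | q.2 < init ω q.1}.indicator
      (fun q => if Y q t ω = x then (1 : ℝ≥0∞) else 0) q)
    (hfin : ∀ x, tupleSum H [x] 1 ∅ ≠ ∞) (l : List (Site d)) :
    factMoment l (configAt init Y t ω) = (tupleSum H l 1 ∅).toReal ∧
      tupleSum H l 1 ∅ ≠ ∞ := by
  -- The one-point tuple sum counts the particles at `u`, so its finiteness makes the `Set.ncard` in
  -- `configAt` an honest count.
  have hf : ∀ u, {q | q ∈ {q : Site d × ℕ | q.2 < init ω q.1} ∧ Y q t ω = u}.Finite := by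
    intro u
    have h1 := hfin u
    simp only [tupleSum, Finset.notMem_empty, if_false, Pi.one_apply, mul_one, hH] at h1
    refine (ENNReal.finite_const_le_of_tsum_ne_top h1 one_ne_zero).subset ?_
    rintro q ⟨hq1, hq2⟩
    simp [Set.indicator_of_mem hq1, hq2]
  have h2 := tupleSum_empty (H := H) (τ := fun q => Y q t ω)
    (e := fun a u => if u = a then 1 else 0) hH hf l
  rw [factSum_single, zero_add] at h2
  have h3 : (fun u => Set.ncard {q | q ∈ {q : Site d × ℕ | q.2 < init ω q.1} ∧ Y q t ω = u}) =
      configAt init Y t ω := rfl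
  rw [h3] at h2
  rw [h2]
  exact ⟨by simp [factMoment], ENNReal.natCast_ne_top _⟩

/-- Joint factorial moments of the particle numbers at two times. -/
lemma integral_factMoment_mul (hp : IsTransition p) (hinit : Measurable init)
    (hmap : P.map init = poissonField d ρ)
    (hY : ∀ q, IsWalk P p q.1 (Y q))
    (hind : iIndepFun (fun (q : Site d × ℕ) (ω : Ω) (t : ℝ≥0) => Y q t ω) P)
    (hind' : IndepFun init (fun (ω : Ω) (q : Site d × ℕ) (t : ℝ≥0) => Y q t ω) P)
    {t s : ℝ} (ht : 0 ≤ t) (hs : 0 ≤ s) (xs ys : List (Site d)) :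
    Integrable (fun ω => factMoment xs (configAt init Y t ω) *
      factMoment ys (configAt init Y s ω)) P ∧
    ∫ ω, factMoment xs (configAt init Y t ω) * factMoment ys (configAt init Y s ω) ∂P =
      jointMoment (ρ : ℝ) (walkProb p |t - s|) xs ys := by
  set X : Site d × ℕ → Ω → Site d × Site d := fun q ω => (Y q t ω, Y q s ω) with hX
  have hmf : IsMarkedField P ρ init X := isMarkedField_walks hinit hmap hY hind hind' ht hs
  set F : List (Site d) → Ω → ℝ≥0∞ := fun l ω =>
    tupleSum (markWeight init X ω) (l.map fstMark) 1 ∅ with hF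
  set G : List (Site d) → Ω → ℝ≥0∞ := fun l ω =>
    tupleSum (markWeight init X ω) (l.map sndMark) 1 ∅ with hG
  have hFm : ∀ l, Measurable (F l) := fun l => IsMarkedField.measurable_tupleSum
    hmf.measurable_markWeight _ (T := fun _ => 1) (fun _ => measurable_const) ∅
  have hGm : ∀ l, Measurable (G l) := fun l => IsMarkedField.measurable_tupleSum
    hmf.measurable_markWeight _ (T := fun _ => 1) (fun _ => measurable_const) ∅
  -- The mean number of particles at each site is `ρ`, so almost surely all the countably many sites
  -- are finitely occupied.
  have hFfin : ∀ᵐ ω ∂P, ∀ x, F [x] ω ≠ ∞ := by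
    rw [ae_all_iff]
    intro x
    have h1 := hmf.lintegral_tupleSum [fstMark x]
    rw [List.map_singleton, List.prod_singleton, markIntensity_fstMark hp hY ht, mul_one] at h1
    filter_upwards [ae_lt_top (hFm [x]) (by
      rw [show ∫⁻ ω, F [x] ω ∂P = ρ from h1]; exact ENNReal.coe_ne_top)] with ω hω using hω.ne
  have hGfin : ∀ᵐ ω ∂P, ∀ x, G [x] ω ≠ ∞ := by
    rw [ae_all_iff]
    intro x
    have h1 := hmf.lintegral_tupleSum [sndMark x]
    rw [List.map_singleton, List.prod_singleton, markIntensity_sndMark hp hY hs, mul_one] at h1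
    filter_upwards [ae_lt_top (hGm [x]) (by
      rw [show ∫⁻ ω, G [x] ω ∂P = ρ from h1]; exact ENNReal.coe_ne_top)] with ω hω using hω.ne
  have hae : ∀ᵐ ω ∂P, factMoment xs (configAt init Y t ω) * factMoment ys (configAt init Y s ω) =
      (F xs ω * G ys ω).toReal := by
    filter_upwards [hFfin, hGfin] with ω h1 h2
    simp only [hF, hG, tupleSum_map] at h1 h2 ⊢
    rw [ENNReal.toReal_mul, ← (factMoment_configAt (init := init) (Y := Y) (t := t)
        (H := fun b => markWeight init X ω (fstMark b)) (fun _ _ => rfl) h1 xs).1,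
      ← (factMoment_configAt (init := init) (Y := Y) (t := s)
        (H := fun b => markWeight init X ω (sndMark b)) (fun _ _ => rfl) h2 ys).1]
  have hnn : ∀ x y, 0 ≤ walkProb p |t - s| x y := hp.walkProb_nonneg (abs_nonneg _)
  have hval : ∫⁻ ω, F xs ω * G ys ω ∂P =
      ENNReal.ofReal (jointMoment (ρ : ℝ) (walkProb p |t - s|) xs ys) := by
    have h1 := hmf.lintegral_tupleSum_mul_tupleSum fstMark sndMark
      (fun x y => ENNReal.ofReal (walkProb p |t - s| x y))
      (markIntensity_fstMark hp hY ht) (markIntensity_sndMark hp hY hs)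
      (markIntensity_fstMark_mul_sndMark hp hY ht hs) xs ys
    -- `jointMoment` is polynomial in its data: evaluated in `ℝ≥0`, it maps both to the extended
    -- nonnegative value of the Mecke formula and to the real one.
    have h2 := map_jointMoment NNReal.toRealHom ρ
      (fun x y => (walkProb p |t - s| x y).toNNReal) xs ys
    have h3 := map_jointMoment ENNReal.ofNNRealHom ρ
      (fun x y => (walkProb p |t - s| x y).toNNReal) xs ys
    simp only [NNReal.coe_toRealHom, Real.coe_toNNReal _ (hnn _ _)] at h2
    rw [← h2, ENNReal.ofReal_coe_nnreal]
    exact h1.trans h3.symm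
  have hm : Measurable (fun ω => F xs ω * G ys ω) := (hFm xs).mul (hGm ys)
  have hne : ∫⁻ ω, F xs ω * G ys ω ∂P ≠ ∞ := by rw [hval]; exact ENNReal.ofReal_ne_top
  refine ⟨(integrable_toReal_of_lintegral_ne_top hm.aemeasurable hne).congr
    (hae.mono fun ω hω => hω.symm), ?_⟩
  rw [integral_congr_ae hae, integral_toReal hm.aemeasurable (ae_lt_top hm hne), hval,
    ENNReal.toReal_ofReal]
  have h2 := map_jointMoment NNReal.toRealHom ρ
    (fun x y => (walkProb p |t - s| x y).toNNReal) xs ys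
  simp only [NNReal.coe_toRealHom, Real.coe_toNNReal _ (hnn _ _)] at h2
  rw [← h2]
  exact NNReal.coe_nonneg _

end walkers

/-! ### Charlier polynomials -/

lemma sum_choose_succ_mul (m : ℕ) (a : ℕ → ℝ) :
    ∑ j ∈ Finset.range (m + 2), ((m + 1).choose j : ℝ) * a j =
      ∑ j ∈ Finset.range (m + 1), (m.choose j : ℝ) * a j +
        ∑ j ∈ Finset.range (m + 1), (m.choose j : ℝ) * a (j + 1) := by
  have h1 : ∑ j ∈ Finset.range (m + 1), (m.choose j : ℝ) * a j =
      ∑ j ∈ Finset.range (m + 2), (m.choose j : ℝ) * a j := by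
    rw [Finset.sum_range_succ _ (m + 1)]
    simp
  rw [h1, Finset.sum_range_succ', Finset.sum_range_succ' _ (m + 1)]
  simp only [Nat.choose_succ_succ, Nat.cast_add, add_mul, Finset.sum_add_distrib]
  simp
  ring

/-- The sum factorises over sites: there are `(m choose j)` ways to keep `j` of `m` copies of a
site. The offset `c` records copies already kept, and Pascal's rule closes the induction. -/
lemma sublistSum_factProd {d : ℕ} (r : ℝ) (η : Config d) (s : Finset (Site d))
    (xs : List (Site d)) (hxs : ∀ a ∈ xs, a ∈ s) (c : Site d → ℕ) (hc : ∀ u ∉ s, c u = 0) :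
    sublistSum r xs (fun l => (factProd η (c + fun u => l.count u) : ℝ)) =
      ∏ u ∈ s, ∑ j ∈ Finset.range (xs.count u + 1),
        ((xs.count u).choose j : ℝ) * (r ^ j * ((η u).descFactorial (c u + j) : ℝ)) := by
  induction xs generalizing c with
  | nil =>
    have h : (c + fun u => List.count u ([] : List (Site d))) = c := by funext u; simp
    simp only [sublistSum, h]
    rw [factProd_eq_prod η c s hc]
    simp
  | cons a xs ih =>
    have ha : a ∈ s := hxs a (by simp)
    have hxs' : ∀ b ∈ xs, b ∈ s := fun b hb => hxs b (by simp [hb])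
    have h1 : ∀ l : List (Site d), (c + fun u => (a :: l).count u) =
        (c + Pi.single a 1) + fun u => l.count u := by
      intro l
      funext u
      by_cases h : u = a
      · subst h; simp; ring
      · simp [h, Ne.symm h]
    simp only [sublistSum, h1]
    rw [ih hxs' c hc, ih hxs' (c + Pi.single a 1) (fun u hu => by
      have : u ≠ a := fun h => hu (h ▸ ha)
      simp [hc u hu, this])]
    rw [← Finset.mul_prod_erase s _ ha, ← Finset.mul_prod_erase s _ ha,
      ← Finset.mul_prod_erase s _ ha]
    have h2 : ∀ u ∈ s.erase a, (∑ j ∈ Finset.range (xs.count u + 1), ((xs.count u).choose j : ℝ) *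
        (r ^ j * ((η u).descFactorial ((c + Pi.single a 1 : Site d → ℕ) u + j) : ℝ))) =
        ∑ j ∈ Finset.range (xs.count u + 1), ((xs.count u).choose j : ℝ) *
        (r ^ j * ((η u).descFactorial (c u + j) : ℝ)) := by
      intro u hu
      simp [Finset.ne_of_mem_erase hu]
    have h3 : ∀ u ∈ s.erase a, (∑ j ∈ Finset.range ((a :: xs).count u + 1),
        (((a :: xs).count u).choose j : ℝ) * (r ^ j * ((η u).descFactorial (c u + j) : ℝ))) =
        ∑ j ∈ Finset.range (xs.count u + 1), ((xs.count u).choose j : ℝ) *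
        (r ^ j * ((η u).descFactorial (c u + j) : ℝ)) := by
      intro u hu
      rw [List.count_cons_of_ne (Finset.ne_of_mem_erase hu).symm]
    rw [Finset.prod_congr rfl h2, Finset.prod_congr rfl h3, ← mul_assoc, ← add_mul]
    congr 1
    rw [List.count_cons_self, sum_choose_succ_mul, Finset.mul_sum]
    congr 1
    refine Finset.sum_congr rfl fun j _ => ?_
    simp only [Pi.add_apply, Pi.single_eq_same]
    rw [show c a + 1 + j = c a + (j + 1) by ring]
    ring

lemma toConfig_eq_count {d k : ℕ} (x : Fin k → Site d) (u : Site d) :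
    toConfig x u = (List.ofFn x).count u := by
  rw [toConfig, Nat.card_eq_fintype_card, Fintype.card_subtype, Finset.card_filter]
  induction k with
  | zero => simp
  | succ k ih =>
    rw [Fin.sum_univ_succ, List.ofFn_succ, List.count_cons, ← ih, add_comm]
    simp

lemma dualPoly_eq_sublistSum {d k : ℕ} (ρ : ℝ≥0) (x : Fin k → Site d) (η : Config d) :
    dualPoly ρ (toConfig x) η =
      sublistSum (-(ρ : ℝ))⁻¹ (List.ofFn x) (fun l => factMoment l η) := by
  have h := sublistSum_factProd (-(ρ : ℝ))⁻¹ η (List.ofFn x).toFinset (List.ofFn x)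
    (fun a ha => by simpa using ha) 0 (fun _ _ => rfl)
  simp only [zero_add, Pi.zero_apply] at h
  unfold factMoment
  rw [h, dualPoly]
  have h1 : ∀ u, charlier ρ (toConfig x u) (η u) =
      ∑ j ∈ Finset.range ((List.ofFn x).count u + 1), (((List.ofFn x).count u).choose j : ℝ) *
        ((-(ρ : ℝ))⁻¹ ^ j * ((η u).descFactorial j : ℝ)) := by
    intro u
    rw [charlier, toConfig_eq_count]
    exact Finset.sum_congr rfl fun j _ => by ring
  simp only [h1]
  refine finprod_eq_prod_of_mulSupport_subset _ fun u hu => ?_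
  by_contra hmem
  have h0 : (List.ofFn x).count u = 0 := List.count_eq_zero.2 (by simpa using hmem)
  exact hu (by simp [h0])

section integrals

variable {Ω α : Type*} [MeasurableSpace Ω] {P : Measure Ω}

lemma integral_sublistSum {r : ℝ} {Φ : List α → Ω → ℝ} (hΦ : ∀ l, Integrable (Φ l) P)
    (xs : List α) : Integrable (fun ω => sublistSum r xs (fun l => Φ l ω)) P ∧
    ∫ ω, sublistSum r xs (fun l => Φ l ω) ∂P = sublistSum r xs (fun l => ∫ ω, Φ l ω ∂P) := by
  induction xs generalizing Φ with
  | nil => exact ⟨hΦ [], rfl⟩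
  | cons a xs ih =>
    obtain ⟨h1, h2⟩ := ih hΦ
    obtain ⟨h3, h4⟩ := ih (Φ := fun m => Φ (a :: m)) fun m => hΦ _
    refine ⟨h1.add (h3.const_mul r), ?_⟩
    simp only [sublistSum]
    rw [integral_add h1 (h3.const_mul r), integral_const_mul, h2, h4]

end integrals

/-- Self-duality of independent walkers: the two-time correlations of the orthogonal
polynomials. -/
lemma IsIRW.integral_dualPoly_mul {d k k' : ℕ} {Ω : Type*} [MeasurableSpace Ω] {P : Measure Ω}
    [IsProbabilityMeasure P] {p : Site d → Site d → ℝ} {ρ : ℝ≥0} {η : ℝ → Ω → Config d}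
    (hη : IsIRW P p ρ η) (hp : IsTransition p) (hρ : 0 < ρ) {t s : ℝ} (ht : 0 ≤ t) (hs : 0 ≤ s)
    (x : Fin k → Site d) (y : Fin k' → Site d) :
    Integrable (fun ω => dualPoly ρ (toConfig x) (η t ω) * dualPoly ρ (toConfig y) (η s ω)) P ∧
    ∫ ω, dualPoly ρ (toConfig x) (η t ω) * dualPoly ρ (toConfig y) (η s ω) ∂P =
      matchSum (ρ : ℝ)⁻¹ (walkProb p |t - s|) (List.ofFn x) (List.ofFn y) := by
  obtain ⟨init, Y, hinit, hmap, hY, hind, hind', hconf⟩ := hη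
  have h0 := fun l m => integral_factMoment_mul hp hinit hmap hY hind hind' ht hs l m
  have h1 : ∀ ω, dualPoly ρ (toConfig x) (η t ω) * dualPoly ρ (toConfig y) (η s ω) =
      sublistSum (-(ρ : ℝ))⁻¹ (List.ofFn y) (fun m => sublistSum (-(ρ : ℝ))⁻¹ (List.ofFn x)
        (fun l => factMoment l (configAt init Y t ω) * factMoment m (configAt init Y s ω))) := by
    intro ω
    rw [dualPoly_eq_sublistSum, dualPoly_eq_sublistSum, hconf t ht, hconf s hs,
      ← sublistSum_mul]
    congr 1
    funext m
    rw [mul_comm, ← sublistSum_mul]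
    congr 1
    funext l
    rw [mul_comm]
  simp only [h1]
  have h2 := fun m => integral_sublistSum (r := (-(ρ : ℝ))⁻¹) (fun l => (h0 l m).1) (List.ofFn x)
  obtain ⟨h3, h4⟩ := integral_sublistSum (r := (-(ρ : ℝ))⁻¹) (fun m => (h2 m).1) (List.ofFn y)
  refine ⟨h3, ?_⟩
  rw [h4]
  simp only [fun m => (h2 m).2, fun l m => (h0 l m).2]
  exact sublistSum_jointMoment (by exact_mod_cast hρ.ne') _ _ _

lemma IsIRW.hasSum_walkProb {d : ℕ} {Ω : Type*} [MeasurableSpace Ω] {P : Measure Ω}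
    [IsProbabilityMeasure P] {p : Site d → Site d → ℝ} {ρ : ℝ≥0} {η : ℝ → Ω → Config d}
    (hη : IsIRW P p ρ η) (hp : IsTransition p) {t : ℝ} (ht : 0 ≤ t) (x : Site d) :
    HasSum (walkProb p t x) 1 := by
  obtain ⟨init, Y, -, -, hY, -⟩ := hη
  have h := (hY (x, 0)).tsum_walkProb ht
  have h1 : Summable (walkProb p t x) := by
    refine (ENNReal.summable_toReal (f := fun y => ENNReal.ofReal (walkProb p t x y))
      (by rw [h]; simp)).congr fun y => ?_
    exact ENNReal.toReal_ofReal (hp.walkProb_nonneg ht x y)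
  rw [← ENNReal.ofReal_tsum_of_nonneg (hp.walkProb_nonneg ht x) h1] at h
  have h2 : ∑' y, walkProb p t x y = 1 := ENNReal.ofReal_eq_one.1 h
  rw [← h2]
  exact h1.hasSum

/-! ### Riemann sums of Schwartz functions -/

/-- On each half line the terms `N²/(N+n)²` are dominated by the telescoping `2N²/(N+n) -
2N²/(N+n+1)`, using `N ≥ 1`; this gives `2N` per side. -/
lemma sum_int_decay_le {N : ℕ} (hN : 1 ≤ N) (S : Finset ℤ) :
    ∑ m ∈ S, ((1 + |(m : ℝ) / N|) ^ 2)⁻¹ ≤ (4 * N : ℝ) := by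
  have hN' : (1 : ℝ) ≤ N := by exact_mod_cast hN
  set g : ℕ → ℝ := fun m => ((1 + (m : ℝ) / N) ^ 2)⁻¹ with hg
  have hg0 : 0 ≤ g := fun m => by positivity
  have hpart : ∀ n : ℕ, ∑ m ∈ Finset.range n, g m ≤
      2 * N - 2 * (N : ℝ) ^ 2 / (N + n) := by
    intro n
    induction n with
    | zero => simp; field_simp; simp
    | succ n ih =>
      rw [Finset.sum_range_succ]
      have h1 : g n = (N : ℝ) ^ 2 / (N + n) ^ 2 := by simp only [hg]; field_simp
      have h2 : (N : ℝ) ^ 2 / (N + n) ^ 2 ≤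
          2 * (N : ℝ) ^ 2 / (N + n) - 2 * (N : ℝ) ^ 2 / (N + (n + 1 : ℕ)) := by
        have hn : (0 : ℝ) ≤ n := n.cast_nonneg
        have h3 : 2 * (N : ℝ) ^ 2 / (N + n) - 2 * (N : ℝ) ^ 2 / (N + (n + 1 : ℕ)) =
            (N : ℝ) ^ 2 * (2 / ((N + n) * (N + n + 1))) := by
          push_cast
          field_simp
          ring
        rw [h3, div_eq_mul_one_div]
        gcongr ?_ * ?_
        rw [div_le_div_iff₀ (by positivity) (by positivity)]
        nlinarith
      rw [h1]
      linarith
  have hpart' : ∀ n : ℕ, ∑ m ∈ Finset.range n, g m ≤ 2 * N := fun n =>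
    (hpart n).trans (sub_le_self _ (by positivity))
  have hsum : Summable g := summable_of_sum_range_le hg0 hpart'
  have htsum : ∑' m, g m ≤ 2 * N := hsum.tsum_le_of_sum_range_le hpart'
  have hsum' : Summable fun n : ℕ => g (n + 1) := (summable_nat_add_iff 1).2 hsum
  have htsum' : ∑' n : ℕ, g (n + 1) ≤ 2 * N := by
    refine le_trans ?_ htsum
    rw [hsum.tsum_eq_zero_add]
    exact le_add_of_nonneg_left (hg0 0)
  have hZ : HasSum (fun m : ℤ => ((1 + |(m : ℝ) / N|) ^ 2)⁻¹)
      (∑' m, g m + ∑' n : ℕ, g (n + 1)) := by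
    refine HasSum.of_nat_of_neg_add_one ?_ ?_
    · refine hsum.hasSum.congr_fun fun n => ?_
      simp only [hg, Int.cast_natCast]
      rw [abs_of_nonneg (by positivity)]
    · refine hsum'.hasSum.congr_fun fun n => ?_
      simp only [hg]
      push_cast
      rw [neg_div, abs_neg, abs_of_nonneg (by positivity)]
  calc _ ≤ ∑' m, g m + ∑' n : ℕ, g (n + 1) :=
        sum_le_hasSum S (fun m _ => by positivity) hZ
    _ ≤ _ := by linarith

/-- Decay of order `2d` dominates a product of one-dimensional decays of order `2`. Enlarging `S` to
a box factorises the sum. Uniformity in `S` yields summability together with the bound. -/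
lemma exists_sum_abs_schwartz_le {d : ℕ} (φ : 𝓢(EuclideanSpace ℝ (Fin d), ℝ)) :
    ∃ C : ℝ, 0 ≤ C ∧ ∀ N : ℕ, 1 ≤ N → ∀ S : Finset (Site d),
      ∑ z ∈ S, |φ (scaled N z)| ≤ C * (N : ℝ) ^ d := by
  classical
  set C := 2 ^ (2 * d) *
    ((Finset.Iic (2 * d, 0)).sup fun m => SchwartzMap.seminorm ℝ m.1 m.2) φ
  have hC : ∀ y, (1 + ‖y‖) ^ (2 * d) * |φ y| ≤ C := by
    intro y
    have h := SchwartzMap.one_add_le_sup_seminorm_apply (𝕜 := ℝ) (m := (2 * d, 0)) (k := 2 * d)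
      (n := 0) le_rfl le_rfl φ y
    rwa [norm_iteratedFDeriv_zero, Real.norm_eq_abs] at h
  have hC0 : 0 ≤ C := le_trans (by positivity) (hC 0)
  have hdecay : ∀ y : EuclideanSpace ℝ (Fin d), |φ y| ≤ C * ∏ i, ((1 + |y i|) ^ 2)⁻¹ := by
    intro y
    have h1 : ∏ i, (1 + |y i|) ^ 2 ≤ (1 + ‖y‖) ^ (2 * d) := by
      calc ∏ i, (1 + |y i|) ^ 2 ≤ ∏ _i : Fin d, (1 + ‖y‖) ^ 2 := by
            refine Finset.prod_le_prod (fun i _ => by positivity) fun i _ => ?_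
            gcongr
            exact PiLp.norm_apply_le y i
        _ = _ := by simp [pow_mul]
    have h2 : 0 < ∏ i, (1 + |y i|) ^ 2 := Finset.prod_pos fun i _ => by positivity
    rw [Finset.prod_inv_distrib, ← div_eq_mul_inv, le_div_iff₀ h2, mul_comm]
    exact (mul_le_mul_of_nonneg_right h1 (abs_nonneg _)).trans (hC y)
  refine ⟨C * 4 ^ d, by positivity, fun N hN S => ?_⟩
  set t : Fin d → Finset ℤ := fun i => S.image fun z => z i
  calc ∑ z ∈ S, |φ (scaled N z)|
      ≤ ∑ z ∈ S, C * ∏ i, ((1 + |(z i : ℝ) / N|) ^ 2)⁻¹ :=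
        Finset.sum_le_sum fun z _ => hdecay _
    _ = C * ∑ z ∈ S, ∏ i, ((1 + |(z i : ℝ) / N|) ^ 2)⁻¹ := by rw [Finset.mul_sum]
    _ ≤ C * ∑ z ∈ Fintype.piFinset t, ∏ i, ((1 + |(z i : ℝ) / N|) ^ 2)⁻¹ := by
        gcongr C * ?_
        refine Finset.sum_le_sum_of_subset_of_nonneg (fun z hz => ?_)
          fun z _ _ => Finset.prod_nonneg fun i _ => by positivity
        exact Fintype.mem_piFinset.2 fun i => Finset.mem_image_of_mem _ hz
    _ = C * ∏ i, ∑ m ∈ t i, ((1 + |(m : ℝ) / N|) ^ 2)⁻¹ := by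
        rw [Finset.prod_univ_sum t fun _ (m : ℤ) => ((1 + |(m : ℝ) / N|) ^ 2)⁻¹]
    _ ≤ C * ∏ _i : Fin d, (4 * N : ℝ) := by
        gcongr C * ?_
        exact Finset.prod_le_prod (fun i _ => Finset.sum_nonneg fun m _ => by positivity)
          fun i _ => sum_int_decay_le hN _
    _ = _ := by simp [mul_pow]; ring

/-! ### Series of integrable functions -/

section series

variable {Ω ι : Type*} [MeasurableSpace Ω] {P : Measure Ω} [Countable ι]

lemma ae_summable_of_summable_integral {F : ι → Ω → ℝ} (hF : ∀ i, Integrable (F i) P)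
    (hsum : Summable fun i => ∫ ω, |F i ω| ∂P) : ∀ᵐ ω ∂P, Summable fun i => ‖F i ω‖ := by
  refine summable_norm_of_tsum_eLpNorm_ne_top le_rfl (fun i => (hF i).1) ?_
  have h : ∀ i, eLpNorm (F i) 1 P = ENNReal.ofReal (∫ ω, |F i ω| ∂P) := fun i => by
    rw [eLpNorm_one_eq_lintegral_enorm, ← ofReal_integral_norm_eq_lintegral_enorm (hF i)]
    rfl
  simp only [h]
  exact hsum.tsum_ofReal_ne_top

lemma integrable_tsum_of_summable_integral {F : ι → Ω → ℝ} (hF : ∀ i, Integrable (F i) P)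
    (hsum : Summable fun i => ∫ ω, |F i ω| ∂P) : Integrable (fun ω => ∑' i, F i ω) P := by
  refine ⟨(AEMeasurable.tsum fun i => (hF i).aemeasurable).aestronglyMeasurable, ?_⟩
  calc ∫⁻ ω, ‖∑' i, F i ω‖ₑ ∂P ≤ ∫⁻ ω, ∑' i, ‖F i ω‖ₑ ∂P :=
        lintegral_mono fun ω => enorm_tsum_le_tsum_enorm
    _ = ∑' i, ∫⁻ ω, ‖F i ω‖ₑ ∂P := lintegral_tsum fun i => (hF i).1.enorm
    _ = ∑' i, ENNReal.ofReal (∫ ω, |F i ω| ∂P) := by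
        refine tsum_congr fun i => ?_
        rw [← ofReal_integral_norm_eq_lintegral_enorm (hF i)]
        rfl
    _ < ∞ := hsum.tsum_ofReal_ne_top.lt_top

end series

/-! ### The correlation of the fluctuation field -/

section measurability

variable {X α : Type*} [MeasurableSpace X]

lemma measurable_pick (ys : List α) {F : α → List α → X → ℝ} (hF : ∀ y l, Measurable (F y l)) :
    Measurable fun u => pick ys (fun y l => F y l u) := by
  induction ys generalizing F with
  | nil => exact measurable_const
  | cons y ys ih => exact (hF y ys).add (ih fun a l => hF a (y :: l))

lemma measurable_matchSum (c : ℝ) {K : X → α → α → ℝ} (hK : ∀ x y, Measurable fun u => K u x y)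
    (xs ys : List α) : Measurable fun u => matchSum c (K u) xs ys := by
  induction xs generalizing ys with
  | nil => cases ys <;> exact measurable_const
  | cons x xs ih =>
    exact (measurable_pick ys fun y l => (hK x y).mul (ih l)).const_mul c

lemma measurable_walkProb {d : ℕ} (p : Site d → Site d → ℝ) (x y : Site d) :
    Measurable fun t => walkProb p t x y := by
  unfold walkProb
  exact Measurable.tsum fun n => by fun_prop

end measurability

/-- The two-point function of the orthogonal polynomials at shifted coordinate vectors. -/
noncomputable def dualKernel {d k : ℕ} (p : Site d → Site d → ℝ) (ρ : ℝ≥0)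
    (x : Fin k → Site d) (u : ℝ) (z w : Site d) : ℝ :=
  matchSum (ρ : ℝ)⁻¹ (walkProb p u) (List.ofFn (shift z x)) (List.ofFn (shift w x))

section kernel

variable {d k : ℕ} {p : Site d → Site d → ℝ} {ρ : ℝ≥0}

lemma dualKernel_nonneg (hp : IsTransition p) {u : ℝ} (hu : 0 ≤ u) (x : Fin k → Site d)
    (z w : Site d) : 0 ≤ dualKernel p ρ x u z w :=
  matchSum_nonneg (by positivity) (hp.walkProb_nonneg hu) _ _

lemma dualKernel_le (hp : IsTransition p) {u : ℝ} (hu : 0 ≤ u) (x : Fin k → Site d)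
    (z w : Site d) : dualKernel p ρ x u z w ≤ ((ρ : ℝ)⁻¹ * k) ^ k := by
  have h := matchSum_le (c := (ρ : ℝ)⁻¹) (by positivity) zero_le_one (hp.walkProb_nonneg hu)
    (hp.walkProb_le_one hu) k (List.ofFn (shift z x)) (List.ofFn (shift w x)) (by simp)
  simpa [dualKernel] using h

/-- Of the `k + 1` kernel factors, `k` are bounded by `b`; the remaining one has total mass `1` for
each of its `k + 1` possible partners. -/
lemma tsum_dualKernel_le {x : Fin (k + 1) → Site d} (hp : IsTransition p) {u b : ℝ} (hu : 0 ≤ u)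
    (hsum : ∀ y, HasSum (walkProb p u y) 1) (hb : 0 ≤ b) (hub : ∀ y y', walkProb p u y y' ≤ b)
    (z : Site d) : Summable (dualKernel p ρ x u z) ∧ ∑' w, dualKernel p ρ x u z w ≤
      (ρ : ℝ)⁻¹ * ((ρ : ℝ)⁻¹ * b * (k + 1 : ℕ)) ^ k * (k + 1 : ℕ) := by
  have h1 : ∀ w, dualKernel p ρ x u z w ≤ (ρ : ℝ)⁻¹ * ((ρ : ℝ)⁻¹ * b * (k + 1 : ℕ)) ^ k *
      ∑ j, walkProb p u (z + x 0) (w + x j) := by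
    intro w
    have h2 := matchSum_cons_le (c := (ρ : ℝ)⁻¹) (by positivity) hb (hp.walkProb_nonneg hu)
      hub (shift z x 0) (List.ofFn fun i : Fin k => shift z x i.succ) (List.ofFn (shift w x))
    rw [List.map_ofFn, List.sum_ofFn, List.length_ofFn, List.length_ofFn] at h2
    rw [dualKernel, List.ofFn_succ (f := shift z x)]
    exact h2
  have h3 : HasSum (fun w => (ρ : ℝ)⁻¹ * ((ρ : ℝ)⁻¹ * b * (k + 1 : ℕ)) ^ k *
      ∑ j, walkProb p u (z + x 0) (w + x j))
      ((ρ : ℝ)⁻¹ * ((ρ : ℝ)⁻¹ * b * (k + 1 : ℕ)) ^ k * (k + 1 : ℕ)) := by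
    refine HasSum.mul_left _ ?_
    have h4 : HasSum (fun w => ∑ j, walkProb p u (z + x 0) (w + x j))
        (∑ _j : Fin (k + 1), (1 : ℝ)) := hasSum_sum fun j _ =>
      ((Equiv.addRight (x j)).hasSum_iff (f := walkProb p u (z + x 0))).2 (hsum (z + x 0))
    simpa using h4
  have h5 : Summable (dualKernel p ρ x u z) :=
    Summable.of_nonneg_of_le (dualKernel_nonneg hp hu x z) h1 h3.summable
  exact ⟨h5, h3.tsum_eq ▸ h5.tsum_le_tsum h1 h3.summable⟩

end kernel

/-! ### Moments and correlations of the field -/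

namespace IsIRW

variable {d k : ℕ} {Ω : Type*} [MeasurableSpace Ω] {P : Measure Ω} [IsProbabilityMeasure P]
  {p : Site d → Site d → ℝ} {ρ : ℝ≥0} {η : ℝ → Ω → Config d}

/-- The case of duality where the second polynomial has no points and equals `1`. -/
lemma integrable_dualPoly (hη : IsIRW P p ρ η) (hp : IsTransition p) (hρ : 0 < ρ) {t : ℝ}
    (ht : 0 ≤ t) (x : Fin k → Site d) :
    Integrable (fun ω => dualPoly ρ (toConfig x) (η t ω)) P := by
  have h := (hη.integral_dualPoly_mul hp hρ ht ht x (fun i : Fin 0 => i.elim0)).1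
  have h1 : ∀ ζ : Config d, dualPoly ρ (toConfig fun i : Fin 0 => (i.elim0 : Site d)) ζ = 1 := by
    intro ζ
    rw [dualPoly_eq_sublistSum]
    simp [sublistSum, factMoment, ← Pi.zero_def, factProd_zero]
  simpa [h1] using h

/-- By `2|ab| ≤ a² + b²` it suffices to bound second moments, which are equal-time instances of
duality. The bound does not depend on `z` or `w`, so the absolute series converges. -/
lemma integral_abs_dualPoly_mul_le (hη : IsIRW P p ρ η) (hp : IsTransition p) (hρ : 0 < ρ)
    {t s : ℝ} (ht : 0 ≤ t) (hs : 0 ≤ s) (x : Fin k → Site d) (z w : Site d) :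
    ∫ ω, |dualPoly ρ (toConfig (shift z x)) (η t ω) *
      dualPoly ρ (toConfig (shift w x)) (η s ω)| ∂P ≤ ((ρ : ℝ)⁻¹ * k) ^ k := by
  obtain ⟨h1, h1'⟩ := hη.integral_dualPoly_mul hp hρ ht ht (shift z x) (shift z x)
  obtain ⟨h2, h2'⟩ := hη.integral_dualPoly_mul hp hρ hs hs (shift w x) (shift w x)
  have h3 := (hη.integral_dualPoly_mul hp hρ ht hs (shift z x) (shift w x)).1
  have hle1 := dualKernel_le (ρ := ρ) hp (abs_nonneg (t - t)) x z z
  have hle2 := dualKernel_le (ρ := ρ) hp (abs_nonneg (s - s)) x w w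
  rw [dualKernel, ← h1'] at hle1
  rw [dualKernel, ← h2'] at hle2
  calc _ ≤ ∫ ω, (1 / 2 : ℝ) * (dualPoly ρ (toConfig (shift z x)) (η t ω) *
          dualPoly ρ (toConfig (shift z x)) (η t ω) + dualPoly ρ (toConfig (shift w x)) (η s ω) *
          dualPoly ρ (toConfig (shift w x)) (η s ω)) ∂P := by
        refine integral_mono h3.abs ((h1.add h2).const_mul _) fun ω => ?_
        simp only [abs_mul]
        set a := dualPoly ρ (toConfig (shift z x)) (η t ω)
        set b := dualPoly ρ (toConfig (shift w x)) (η s ω)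
        rw [← abs_mul_abs_self a, ← abs_mul_abs_self b]
        nlinarith [sq_nonneg (|a| - |b|)]
    _ ≤ _ := by
        rw [integral_const_mul, integral_add h1 h2]
        linarith

variable {φ : 𝓢(EuclideanSpace ℝ (Fin d), ℝ)} {N : ℕ}

lemma ae_summable_fieldTerm (hη : IsIRW P p ρ η) (hp : IsTransition p) (hρ : 0 < ρ)
    (hφ : Summable fun z : Site d => |φ (scaled N z)|) {t : ℝ} (ht : 0 ≤ t)
    (x : Fin k → Site d) : ∀ᵐ ω ∂P, Summable fun z => ‖fieldTerm ρ φ N x (η t ω) z‖ := by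
  refine ae_summable_of_summable_integral
    (fun z => (hη.integrable_dualPoly hp hρ ht (shift z x)).const_mul (φ (scaled N z))) ?_
  refine Summable.of_nonneg_of_le (fun z => integral_nonneg fun ω => abs_nonneg _) (fun z => ?_)
    (hφ.mul_right (1 + ((ρ : ℝ)⁻¹ * k) ^ k))
  change ∫ ω, |φ (scaled N z) * dualPoly ρ (toConfig (shift z x)) (η t ω)| ∂P ≤ _
  simp only [abs_mul]
  rw [integral_const_mul]
  refine mul_le_mul_of_nonneg_left ?_ (abs_nonneg _)
  have h1 := hη.integral_abs_dualPoly_mul_le hp hρ ht ht x z z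
  have h2 := (hη.integral_dualPoly_mul hp hρ ht ht (shift z x) (shift z x)).1.abs
  calc ∫ ω, |dualPoly ρ (toConfig (shift z x)) (η t ω)| ∂P
      ≤ ∫ ω, (1 + |dualPoly ρ (toConfig (shift z x)) (η t ω) *
          dualPoly ρ (toConfig (shift z x)) (η t ω)|) ∂P := by
        refine integral_mono (hη.integrable_dualPoly hp hρ ht (shift z x)).abs
          ((integrable_const 1).add h2) fun ω => ?_
        simp only [abs_mul]
        nlinarith [sq_nonneg (|dualPoly ρ (toConfig (shift z x)) (η t ω)| - 1)]
    _ ≤ _ := by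
        rw [integral_add (integrable_const 1) h2]
        simpa using h1

/-- The product of the fields at two times: integrability, and the two-time correlation as a
double series. -/
lemma integrable_field_mul (hη : IsIRW P p ρ η) (hp : IsTransition p) (hρ : 0 < ρ)
    (hφ : Summable fun z : Site d => |φ (scaled N z)|) {t s : ℝ} (ht : 0 ≤ t) (hs : 0 ≤ s)
    (x : Fin k → Site d) :
    Integrable (fun ω => field ρ φ N x (η t ω) * field ρ φ N x (η s ω)) P ∧
    ∫ ω, field ρ φ N x (η t ω) * field ρ φ N x (η s ω) ∂P =
      ∑' q : Site d × Site d, φ (scaled N q.1) * φ (scaled N q.2) *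
        dualKernel p ρ x |t - s| q.1 q.2 := by
  set F : Site d × Site d → Ω → ℝ := fun q ω => φ (scaled N q.1) * φ (scaled N q.2) *
    (dualPoly ρ (toConfig (shift q.1 x)) (η t ω) *
      dualPoly ρ (toConfig (shift q.2 x)) (η s ω)) with hF
  have hFi : ∀ q, Integrable (F q) P := fun q =>
    (hη.integral_dualPoly_mul hp hρ ht hs (shift q.1 x) (shift q.2 x)).1.const_mul _
  have hFs : Summable fun q => ∫ ω, |F q ω| ∂P := by
    refine Summable.of_nonneg_of_le (fun z => integral_nonneg fun ω => abs_nonneg _) (fun q => ?_)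
      ((hφ.mul_of_nonneg hφ (fun _ => abs_nonneg _) fun _ => abs_nonneg _).mul_right
        (((ρ : ℝ)⁻¹ * k) ^ k))
    simp only [hF, abs_mul (φ (scaled N q.1) * φ (scaled N q.2))]
    rw [integral_const_mul, abs_mul]
    exact mul_le_mul_of_nonneg_left (hη.integral_abs_dualPoly_mul_le hp hρ ht hs x q.1 q.2)
      (by positivity)
  have hae : ∀ᵐ ω ∂P, ∑' q, F q ω = field ρ φ N x (η t ω) * field ρ φ N x (η s ω) := by
    filter_upwards [hη.ae_summable_fieldTerm hp hρ hφ ht x,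
      hη.ae_summable_fieldTerm hp hρ hφ hs x] with ω h1 h2
    rw [field, field, tsum_mul_tsum_of_summable_norm h1 h2]
    refine tsum_congr fun q => ?_
    simp only [hF, fieldTerm]
    ring
  refine ⟨(integrable_tsum_of_summable_integral hFi hFs).congr hae, ?_⟩
  rw [← integral_congr_ae hae, ← integral_tsum_of_summable_integral_norm hFi hFs]
  refine tsum_congr fun q => ?_
  simp only [hF]
  rw [integral_const_mul, (hη.integral_dualPoly_mul hp hρ ht hs _ _).2]
  rfl

/-- In the double series one copy of `φ` is bounded by `M`, so that the kernel can be summed over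
`w`; the other copy is summed over `z` and costs `S`. -/
lemma abs_field_mul_le {k : ℕ} (hη : IsIRW P p ρ η) (hp : IsTransition p) (hρ : 0 < ρ) {S M b : ℝ}
    (hφ : ∀ A : Finset (Site d), ∑ z ∈ A, |φ (scaled N z)| ≤ S) (hM : ∀ y, |φ y| ≤ M)
    {t s : ℝ} (ht : 0 ≤ t) (hs : 0 ≤ s) (hb : 0 ≤ b)
    (htb : ∀ y y', walkProb p |t - s| y y' ≤ b) (x : Fin (k + 1) → Site d) :
    |∫ ω, field ρ φ N x (η t ω) * field ρ φ N x (η s ω) ∂P| ≤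
      S * (M * ((ρ : ℝ)⁻¹ * ((ρ : ℝ)⁻¹ * b * (k + 1 : ℕ)) ^ k * (k + 1 : ℕ))) := by
  have hφs : Summable fun z : Site d => |φ (scaled N z)| :=
    summable_of_sum_le (fun _ => abs_nonneg _) hφ
  have hM0 : 0 ≤ M := (abs_nonneg _).trans (hM 0)
  rw [(hη.integrable_field_mul hp hρ hφs ht hs x).2]
  have hu : 0 ≤ |t - s| := abs_nonneg _
  set u := |t - s|
  set E := (ρ : ℝ)⁻¹ * ((ρ : ℝ)⁻¹ * b * (k + 1 : ℕ)) ^ k * (k + 1 : ℕ) with hE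
  have hnorm : ∀ q : Site d × Site d, ‖φ (scaled N q.1) * φ (scaled N q.2) *
      dualKernel p ρ x u q.1 q.2‖ =
      |φ (scaled N q.1)| * (|φ (scaled N q.2)| * dualKernel p ρ x u q.1 q.2) := by
    intro q
    rw [Real.norm_eq_abs, abs_mul, abs_mul, abs_of_nonneg (dualKernel_nonneg hp hu x q.1 q.2),
      mul_assoc]
  have hsum : Summable fun q : Site d × Site d => |φ (scaled N q.1)| *
      (|φ (scaled N q.2)| * dualKernel p ρ x u q.1 q.2) := by
    refine Summable.of_nonneg_of_le (fun q => mul_nonneg (abs_nonneg _)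
      (mul_nonneg (abs_nonneg _) (dualKernel_nonneg hp hu x _ _))) (fun q => ?_)
      ((hφs.mul_of_nonneg hφs (fun _ => abs_nonneg _) fun _ => abs_nonneg _).mul_right
        (((ρ : ℝ)⁻¹ * (k + 1 : ℕ)) ^ (k + 1)))
    rw [← mul_assoc]
    exact mul_le_mul_of_nonneg_left (dualKernel_le hp hu x _ _) (by positivity)
  have hinner : ∀ z, Summable (fun w => |φ (scaled N w)| * dualKernel p ρ x u z w) ∧
      ∑' w, |φ (scaled N w)| * dualKernel p ρ x u z w ≤ M * E := by
    intro z
    obtain ⟨h1, h2⟩ := tsum_dualKernel_le (ρ := ρ) (x := x) hp hu (hη.hasSum_walkProb hp hu)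
      hb htb z
    have h3 : ∀ w, |φ (scaled N w)| * dualKernel p ρ x u z w ≤ M * dualKernel p ρ x u z w :=
      fun w => mul_le_mul_of_nonneg_right (hM _) (dualKernel_nonneg hp hu x z w)
    have h4 : Summable (fun w => |φ (scaled N w)| * dualKernel p ρ x u z w) :=
      Summable.of_nonneg_of_le (fun w => mul_nonneg (abs_nonneg _)
        (dualKernel_nonneg hp hu x z w)) h3 (h1.mul_left M)
    refine ⟨h4, (h4.tsum_le_tsum h3 (h1.mul_left M)).trans ?_⟩
    rw [tsum_mul_left]
    exact mul_le_mul_of_nonneg_left h2 hM0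
  have hE0 : 0 ≤ E := by positivity
  clear_value E u
  calc _ ≤ ∑' q : Site d × Site d, |φ (scaled N q.1)| *
        (|φ (scaled N q.2)| * dualKernel p ρ x u q.1 q.2) := by
        rw [← Real.norm_eq_abs]
        refine (norm_tsum_le_tsum_norm ?_).trans (le_of_eq (tsum_congr hnorm))
        exact hsum.congr fun q => (hnorm q).symm
    _ = ∑' z, |φ (scaled N z)| * ∑' w, |φ (scaled N w)| * dualKernel p ρ x u z w := by
        have h7 : ∀ z, Summable fun w => |φ (scaled N z)| *
            (|φ (scaled N w)| * dualKernel p ρ x u z w) := fun z =>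
          (hinner z).1.mul_left |φ (scaled N z)|
        refine (Summable.tsum_prod' hsum h7).trans (tsum_congr fun z => ?_)
        exact tsum_mul_left (a := |φ (scaled N z)|)
    _ ≤ ∑' z, |φ (scaled N z)| * (M * E) := by
        have h5 : ∀ z, |φ (scaled N z)| * ∑' w, |φ (scaled N w)| * dualKernel p ρ x u z w ≤
            |φ (scaled N z)| * (M * E) := fun z =>
          mul_le_mul_of_nonneg_left (hinner z).2 (abs_nonneg _)
        refine Summable.tsum_le_tsum h5 ?_ (hφs.mul_right _)
        exact Summable.of_nonneg_of_le (fun z => mul_nonneg (abs_nonneg _)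
          (tsum_nonneg fun w => mul_nonneg (abs_nonneg _) (dualKernel_nonneg hp hu x z w)))
          h5 (hφs.mul_right _)
    _ ≤ S * (M * E) := by
        have h6 : ∑' z : Site d, |φ (scaled N z)| ≤ S := hφs.tsum_le_of_sum_le hφ
        rw [tsum_mul_right]
        exact mul_le_mul_of_nonneg_right h6 (mul_nonneg hM0 hE0)

/-- On the square the correlation equals an explicit series of measurable functions of the two
times, and it is bounded by the previous estimate with `b = 1`. -/
lemma integrableOn_correlation {k : ℕ} (hη : IsIRW P p ρ η) (hp : IsTransition p) (hρ : 0 < ρ)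
    {S : ℝ} (hφ : ∀ A : Finset (Site d), ∑ z ∈ A, |φ (scaled N z)| ≤ S)
    (x : Fin (k + 1) → Site d) (T : ℝ) :
    IntegrableOn (fun r : ℝ × ℝ => correlation P ρ η φ N x r.1 r.2)
      (Set.Icc 0 T ×ˢ Set.Icc 0 T) := by
  have hφs : Summable fun z : Site d => |φ (scaled N z)| :=
    summable_of_sum_le (fun _ => abs_nonneg _) hφ
  have hms : MeasurableSet (Set.Icc 0 T ×ˢ Set.Icc 0 T : Set (ℝ × ℝ)) :=
    measurableSet_Icc.prod measurableSet_Icc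
  set f : ℝ × ℝ → ℝ := fun r => ∑' q : Site d × Site d, φ (scaled N q.1) * φ (scaled N q.2) *
    dualKernel p ρ x |(N : ℝ) ^ 2 * r.1 - (N : ℝ) ^ 2 * r.2| q.1 q.2 with hf
  have hfm : Measurable f := by
    refine Measurable.tsum fun q => Measurable.const_mul ?_ _
    refine measurable_matchSum _ (K := fun (r : ℝ × ℝ) =>
      walkProb p |(N : ℝ) ^ 2 * r.1 - (N : ℝ) ^ 2 * r.2|) (fun y y' => ?_) _ _
    exact (measurable_walkProb p y y').comp (by fun_prop)
  have hfc : Set.EqOn f (fun r : ℝ × ℝ => correlation P ρ η φ N x r.1 r.2)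
      (Set.Icc 0 T ×ˢ Set.Icc 0 T) := by
    rintro ⟨t, s⟩ ⟨ht, hs⟩
    exact (hη.integrable_field_mul hp hρ hφs (mul_nonneg (sq_nonneg _) ht.1)
      (mul_nonneg (sq_nonneg _) hs.1) x).2.symm
  refine IntegrableOn.congr_fun ?_ hfc hms
  refine Measure.integrableOn_of_bounded
    (M := S * (SchwartzMap.seminorm ℝ 0 0 φ *
      ((ρ : ℝ)⁻¹ * ((ρ : ℝ)⁻¹ * 1 * (k + 1 : ℕ)) ^ k * (k + 1 : ℕ)))) ?_
    hfm.aestronglyMeasurable ?_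
  · exact (isCompact_Icc.prod isCompact_Icc).measure_lt_top.ne
  · filter_upwards [ae_restrict_mem hms] with r hr
    rw [hfc hr]
    exact hη.abs_field_mul_le hp hρ hφ (SchwartzMap.norm_le_seminorm ℝ φ)
      (mul_nonneg (sq_nonneg _) hr.1.1) (mul_nonneg (sq_nonneg _) hr.2.1) zero_le_one
      (hp.walkProb_le_one (abs_nonneg _)) x

end IsIRW

/-- An integral over the square of a function which is bounded by `D` near the diagonal and by
`D * B` away from it. -/
lemma abs_integral_integral_le {f : ℝ → ℝ → ℝ} {T ε D B : ℝ} (hT : 0 ≤ T) (hε : 0 ≤ ε)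
    (hD : 0 ≤ D) (hB : 0 ≤ B)
    (h1 : ∀ t s, 0 ≤ t → 0 ≤ s → |f t s| ≤ D)
    (h2 : ∀ t s, 0 ≤ t → 0 ≤ s → ε < |t - s| → |f t s| ≤ D * B) :
    |∫ t in (0 : ℝ)..T, ∫ s in (0 : ℝ)..T, f t s| ≤ D * (2 * ε + B * T) * T := by
  have hinner : ∀ t ∈ Set.uIoc 0 T, ‖∫ s in (0 : ℝ)..T, f t s‖ ≤ D * (2 * ε + B * T) := by
    intro t ht
    rw [Set.uIoc_of_le hT] at ht
    -- The majorant is `D` on the window of length `2ε` around `t`, plus `D * B` throughout.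
    set I : Set ℝ := Set.Icc (t - ε) (t + ε)
    have hI : Integrable (I.indicator fun _ => D) volume :=
      (integrable_indicator_iff measurableSet_Icc).2 continuousOn_const.integrableOn_Icc
    have hb := intervalIntegral.norm_integral_le_of_norm_le (μ := volume) (f := f t)
      (g := fun s => I.indicator (fun _ => D) s + D * B) hT
      (Eventually.of_forall fun s hs => by
        by_cases hsI : s ∈ I
        · rw [Set.indicator_of_mem hsI]
          exact (h1 t s ht.1.le hs.1.le).trans (le_add_of_nonneg_right (by positivity))
        · rw [Set.indicator_of_notMem hsI, zero_add]
          refine h2 t s ht.1.le hs.1.le ?_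
          by_contra hcon
          rw [not_lt, abs_le] at hcon
          exact hsI ⟨by linarith, by linarith⟩)
      (hI.intervalIntegrable.add intervalIntegrable_const)
    refine hb.trans ?_
    rw [intervalIntegral.integral_add hI.intervalIntegrable intervalIntegrable_const,
      intervalIntegral.integral_const, intervalIntegral.integral_of_le hT]
    have h3 : ∫ s in Set.Ioc 0 T, I.indicator (fun _ => D) s ≤ ∫ s, I.indicator (fun _ => D) s :=
      setIntegral_le_integral hI (Eventually.of_forall fun s =>
        Set.indicator_nonneg (fun _ _ => hD) s)
    have h4 : ∫ s, I.indicator (fun _ => D) s = 2 * ε * D := by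
      rw [integral_indicator measurableSet_Icc, setIntegral_const, measureReal_def,
        Real.volume_Icc, ENNReal.toReal_ofReal (by linarith), smul_eq_mul]
      ring
    simp only [smul_eq_mul, sub_zero]
    linarith
  have h := intervalIntegral.norm_integral_le_of_norm_le_const hinner
  rwa [sub_zero, abs_of_nonneg hT] at h

end BGP

/-! ### Conclusion: balancing the two regimes -/

theorem theorem3p4 {d k : ℕ} (hd : 1 ≤ d) (hk : 1 ≤ k)
    (p : BGP.Site d → BGP.Site d → ℝ) (hp : BGP.IsTransition p)
    (ρ : ℝ≥0) (hρ : 0 < ρ)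
    {Ω : Type*} [MeasurableSpace Ω] (P : Measure Ω) [IsProbabilityMeasure P]
    (η : ℝ → Ω → BGP.Config d) (hη : BGP.IsIRW P p ρ η)
    (φ : 𝓢(EuclideanSpace ℝ (Fin d), ℝ)) (x : Fin k → BGP.Site d) :
    -- the fields are well defined and all expectations and integrals below exist
    (∀ N : ℕ, 1 ≤ N → ∀ t : ℝ, 0 ≤ t →
      ∀ᵐ ω ∂P, Summable (BGP.fieldTerm ρ φ N x (η t ω))) ∧
    (∀ N : ℕ, 1 ≤ N → ∀ t s : ℝ, 0 ≤ t → 0 ≤ s →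
      Integrable (fun ω => BGP.field ρ φ N x (η t ω) * BGP.field ρ φ N x (η s ω)) P) ∧
    (∀ N : ℕ, 1 ≤ N → ∀ T : ℝ, 0 < T →
      IntegrableOn (fun r : ℝ × ℝ => BGP.correlation P ρ η φ N x r.1 r.2)
        (Set.Icc 0 T ×ˢ Set.Icc 0 T)) ∧
    -- the quantitative bound
    ∀ T : ℝ, 0 < T → ∃ C : ℝ, ∀ᶠ N : ℕ in atTop,
      1 / (N : ℝ) ^ d *
          (∫ t in (0 : ℝ)..T, ∫ s in (0 : ℝ)..T, BGP.correlation P ρ η φ N x t s) ≤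
        C * (N : ℝ) ^ (-(2 * ((k : ℝ) - 1) * (d : ℝ)) / (2 + ((k : ℝ) - 1) * (d : ℝ))) := by
  -- From here on `k` stands for the order minus one, the number of kernel factors that can be made
  -- small.
  obtain ⟨k, rfl⟩ : ∃ k', k = k' + 1 := ⟨k - 1, by omega⟩
  obtain ⟨C₀, hC₀, hφ⟩ := BGP.exists_sum_abs_schwartz_le φ
  have hφs : ∀ N : ℕ, 1 ≤ N → Summable fun z : BGP.Site d => |φ (BGP.scaled N z)| :=
    fun N hN => summable_of_sum_le (fun _ => abs_nonneg _) (hφ N hN)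
  refine ⟨fun N hN t ht => ?_, fun N hN t s ht hs => ?_, fun N hN T _ => ?_, fun T hT => ?_⟩
  · filter_upwards [hη.ae_summable_fieldTerm hp hρ (hφs N hN) ht x] with ω hω using hω.of_norm
  · exact (hη.integrable_field_mul hp hρ (hφs N hN) ht hs x).1
  · exact hη.integrableOn_correlation hp hρ (hφ N hN) x T
  obtain ⟨A, hA, hheat⟩ := hp.exists_walkProb_le
  set M := SchwartzMap.seminorm ℝ 0 0 φ
  have hM : ∀ y, |φ y| ≤ M := SchwartzMap.norm_le_seminorm ℝ φ
  have hM0 : 0 ≤ M := (abs_nonneg _).trans (hM 0)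
  set E := (ρ : ℝ)⁻¹ * ((ρ : ℝ)⁻¹ * (k + 1 : ℕ)) ^ k * (k + 1 : ℕ) with hE
  have hE0 : 0 ≤ E := by positivity
  refine ⟨C₀ * (M * E) * (2 + A ^ k * T) * T, ?_⟩
  filter_upwards [eventually_ge_atTop 1] with N hN
  have hN0 : (0 : ℝ) < N := by exact_mod_cast hN
  set a : ℝ := (k : ℝ) * d with ha
  have ha0 : 0 ≤ a := by positivity
  have hexp : -(2 * (((k + 1 : ℕ) : ℝ) - 1) * (d : ℝ)) / (2 + (((k + 1 : ℕ) : ℝ) - 1) * (d : ℝ)) =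
      -(2 * a) / (2 + a) := by
    push_cast
    rw [ha]
    ring_nf
  rw [hexp]
  -- The cut-off solves `ε = (N²ε)^(-a/2)`; it balances the strip near the diagonal against the rest
  -- and is itself the claimed rate.
  set ε : ℝ := (N : ℝ) ^ (-(2 * a) / (2 + a)) with hε
  have hε0 : 0 < ε := Real.rpow_pos_of_pos hN0 _
  have hNε : (((N : ℝ) ^ 2 * ε) ^ (-((d : ℝ) / 2))) ^ k = ε := by
    rw [hε, ← Real.rpow_natCast (N : ℝ) 2, ← Real.rpow_add hN0, ← Real.rpow_mul hN0.le,
      ← Real.rpow_natCast, ← Real.rpow_mul hN0.le]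
    congr 1
    have h2a : 2 + a ≠ 0 := by positivity
    field_simp
    push_cast
    rw [ha]
    ring
  have hpull : ∀ b : ℝ, C₀ * (N : ℝ) ^ d * (M * ((ρ : ℝ)⁻¹ * ((ρ : ℝ)⁻¹ * b * (k + 1 : ℕ)) ^ k *
      (k + 1 : ℕ))) = C₀ * (N : ℝ) ^ d * (M * E) * b ^ k := by
    intro b
    rw [hE, mul_right_comm (ρ : ℝ)⁻¹ b, mul_pow _ b]
    ring
  have hbound := BGP.abs_integral_integral_le (f := BGP.correlation P ρ η φ N x) (T := T) (ε := ε)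
    (D := C₀ * (N : ℝ) ^ d * (M * E)) (B := A ^ k * ε) hT.le hε0.le (by positivity) (by positivity)
    -- Near the diagonal only `walkProb ≤ 1` is available.
    (fun t s ht hs => by
      have h := hη.abs_field_mul_le hp hρ (hφ N hN) hM (mul_nonneg (sq_nonneg (N : ℝ)) ht)
        (mul_nonneg (sq_nonneg (N : ℝ)) hs) zero_le_one (hp.walkProb_le_one (abs_nonneg _)) x
      rwa [hpull, one_pow, mul_one] at h)
    -- Away from the diagonal the lag is at least `N²ε`. The heat kernel bound decreases in time, so
    -- its value there serves as `b`, and `b ^ k = A ^ k * ε` by the choice of `ε`.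
    (fun t s ht hs hts => by
      have hu : (N : ℝ) ^ 2 * ε ≤ |(N : ℝ) ^ 2 * t - (N : ℝ) ^ 2 * s| := by
        rw [← mul_sub, abs_mul, abs_of_nonneg (sq_nonneg (N : ℝ))]
        gcongr
      have hpos : 0 < (N : ℝ) ^ 2 * ε := by positivity
      have h := hη.abs_field_mul_le hp hρ (hφ N hN) hM (mul_nonneg (sq_nonneg (N : ℝ)) ht)
        (mul_nonneg (sq_nonneg (N : ℝ)) hs)
        (b := A * ((N : ℝ) ^ 2 * ε) ^ (-((d : ℝ) / 2))) (by positivity)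
        (fun y y' => (hheat _ (hpos.trans_le hu) y y').trans (by
          gcongr ?_ * ?_
          exact Real.rpow_le_rpow_of_nonpos hpos hu (by
            have : (0 : ℝ) ≤ d := d.cast_nonneg
            linarith))) x
      rwa [hpull, mul_pow, hNε] at h)
  calc _ ≤ 1 / (N : ℝ) ^ d *
        (C₀ * (N : ℝ) ^ d * (M * E) * (2 * ε + A ^ k * ε * T) * T) := by
        gcongr
        exact (le_abs_self _).trans hbound
    _ = _ := by
        field_simp
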